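/- **Setting.** Let $T$ be a tree with root $\rho$ whose vertex degrees are uniformly bounded. Write $|x|$ for the distance from $\rho$ to $x$, and direct edges $(x,y)$ away from the root. A *cutset* is a finite set $S$ of vertices such that every infinite self-avoiding path from $\rho$ meets $S$; an *antichain* is a cutset no proper subset of which is a cutset. The *branching number* of $T$ is $$\mathrm{br}(T)=\inf\Big\{\lambda>0:\ \inf_{S\text{ cutset}}\ \sum_{x\in S}\lambda^{-|x|}=0\Big\}.$$ For a cutset $S$ let $\mathrm{Ins}(S)$ be the connected component of $T\setminus S$ containing $\rho$ (empty if $\rho\in S$), and let $\mathrm{Ins}_E(S)$ be the set of directed edges $(x,y)$ with $x\in \mathrm{Ins}(S)$. Let $\mathcal A$ be a finite set, let $M$ be the $\mathcal A\times\mathcal A$ transition matrix of an ergodic (that is, irreducible and aperiodic) Markov chain, and let $|\lambda_2(M)|$ be the second largest absolute value of the complex eigenvalues of $M$, counted with multiplicity (taken to be $0$ if $|\mathcal A|\le 1$). For a finite set $\mathcal B$, a stochastic $\mathcal A\times\mathcal B$ matrix $N$, an antichain $S$ and $\ell\in\mathcal A$, let $\mu[N]^S_\ell$ be the distribution on $\mathcal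 B^S$ given by $$\mu[N]^S_\ell(\tau)=\sum_{\sigma\in\mathcal A^{\mathrm{Ins}(S)\cup S}}\mathbf 1_{\{\sigma(\rho)=\ell\}}\prod_{(x,y)\in \mathrm{Ins}_E(S)}M_{\sigma(x),\sigma(y)}\ \prod_{y\in S}N_{\sigma(y),\tau(y)} .$$ Let $D_V(\mu,\mu')=\frac12\sum_\omega|\mu(\omega)-\mu'(\omega)|$. Say that reconstruction is *solvable through $N$* if there are $i,j\in\mathcal A$ with $$\inf_{S\text{ antichain}}D_V\big(\mu[N]^S_i,\mu[N]^S_j\big)>0 .$$ The reconstruction problem for $T$ and $M$ is - *robust-solvable* if for every integer $k\ge0$ it is solvable through $N=M^k$; - *$\nu$-robust-solvable*, for a distribution $\nu$ on $\mathcal A$, if for every $0\le\varepsilon<1$ it is solvable through $N_{i,j}=(1-\varepsilon)\mathbf 1_{\{i=j\}}+\varepsilon\nu_j$; - *erasure-robust-solvable* if for every $0\le\epsilon<1$ it is solvable through the matrix $N$ from $\mathcal A$ to $\mathcal A\cup\{*\}$ (with $*\notin\mathcal A$) given by $N_{i,i}=1-\epsilon$, $N_{i,*}=\epsilon$ and $N_{i,j}=0$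 otherwise. A distribution $\nu$ on $\mathcal A$ is *nondegenerate* if $\nu_i>0$ for all $i\in\mathcal A$. **Theorem 3.3.** If $\mathrm{br}(T)\,|\lambda_2(M)|^2<1$, then: 1. the reconstruction problem is not robust-solvable; 2. for every nondegenerate $\nu$, the reconstruction problem is not $\nu$-robust-solvable; 3. if all the entries of $M$ are nonzero, then the reconstruction problem is not erasure-robust-solvable. -/

import Mathlib

/-! ### Rooted trees

A rooted tree is a graph `G : SimpleGraph V` with `G.IsTree` together with a root `ρ : V`.  The level
`|x|` of a vertex is `G.dist ρ x`, and edges are directed away from the root. -/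

/-- There is a uniform bound on the degrees of the vertices. -/
def BoundedDegree {V : Type*} (G : SimpleGraph V) : Prop :=
  ∃ K : ℕ, ∀ x : V, (G.neighborSet x).encard ≤ K

/-- `(x, y)` is an edge of the graph, directed away from the root. -/
def IsChild {V : Type*} (G : SimpleGraph V) (ρ x y : V) : Prop :=
  G.Adj x y ∧ G.dist ρ y = G.dist ρ x + 1

/-- `γ` is an infinite self avoiding path starting from the root. -/
def IsRay {V : Type*} (G : SimpleGraph V) (ρ : V) (γ : ℕ → V) : Prop :=
  γ 0 = ρ ∧ (∀ n, G.Adj (γ n) (γ (n + 1))) ∧ Function.Injective γ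

/-- A cutset is a finite set of vertices met by every infinite self avoiding path from the root. -/
def IsCutset {V : Type*} (G : SimpleGraph V) (ρ : V) (S : Finset V) : Prop :=
  ∀ γ : ℕ → V, IsRay G ρ γ → ∃ n, γ n ∈ S

/-- An antichain is a cutset no proper subset of which is a cutset. -/
def IsAntichainCutset {V : Type*} (G : SimpleGraph V) (ρ : V) (S : Finset V) : Prop :=
  IsCutset G ρ S ∧ ∀ S' : Finset V, S' ⊂ S → ¬ IsCutset G ρ S'

/-- The branching number `inf {r > 0 : inf over cutsets S of ∑_{x ∈ S} r ^ (-|x|) equals 0}`. -/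
noncomputable def branchingNumber {V : Type*} (G : SimpleGraph V) (ρ : V) : ℝ :=
  sInf {r : ℝ | 0 < r ∧
    ⨅ S : {S : Finset V // IsCutset G ρ S}, ∑ x ∈ S.1, r ^ (-(G.dist ρ x : ℤ)) = 0}

/-- The inside of `S`: the connected component of the root in the graph with `S` removed. -/
def Ins {V : Type*} (G : SimpleGraph V) (ρ : V) (S : Finset V) : Set V :=
  {x | ∃ p : G.Walk ρ x, ∀ z ∈ p.support, z ∉ S}

/-- The inside of `S` together with `S`. -/
def InsClosure {V : Type*} (G : SimpleGraph V) (ρ : V) (S : Finset V) : Set V :=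
  Ins G ρ S ∪ (S : Set V)

theorem root_mem_insClosure {V : Type*} (G : SimpleGraph V) (ρ : V) (S : Finset V) :
    ρ ∈ InsClosure G ρ S := by
  by_cases h : ρ ∈ S
  · exact Or.inr h
  · exact Or.inl ⟨.nil, by simpa using h⟩

/-- In an infinite, connected, locally finite graph there is an infinite self avoiding path from
every vertex. -/
theorem exists_isRay {V : Type*} [Infinite V] (G : SimpleGraph V) (hG : G.Connected)
    (hfin : ∀ x, (G.neighborSet x).Finite) (ρ : V) : ∃ γ : ℕ → V, IsRay G ρ γ := by
  let D : V → Set V := fun v => {w | G.dist ρ w = G.dist ρ v + G.dist v w}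
  have step : ∀ v : {v // (D v).Infinite}, ∃ u : {v // (D v).Infinite},
      G.Adj v.1 u.1 ∧ G.dist ρ u.1 = G.dist ρ v.1 + 1 := by
    rintro ⟨v, hv⟩
    by_contra hcon
    push Not at hcon
    apply hv
    have hsub : D v ⊆ {v} ∪ ⋃ u ∈ {u ∈ G.neighborSet v | G.dist ρ u = G.dist ρ v + 1}, D u := by
      intro w hw
      by_cases hwv : w = v
      · left; exact hwv
      right
      obtain ⟨p, hp⟩ := hG.exists_walk_length_eq_dist v w
      cases p with
      | nil => exact absurd rfl hwv
      | @cons _ u _ h p =>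
        have h1 : G.dist u w ≤ p.length := G.dist_le p
        have h2 : G.dist ρ w ≤ G.dist ρ u + G.dist u w := hG.dist_triangle
        have h3 : G.dist ρ u ≤ G.dist ρ v + G.dist v u := hG.dist_triangle
        have h4 : G.dist v u = 1 := SimpleGraph.dist_eq_one_iff_adj.2 h
        have h5 : G.dist ρ w = G.dist ρ v + G.dist v w := hw
        rw [SimpleGraph.Walk.length_cons] at hp
        simp only [Set.mem_iUnion]
        exact ⟨u, ⟨h, by omega⟩, show G.dist ρ w = G.dist ρ u + G.dist u w by omega⟩
    refine Set.Finite.subset ((Set.finite_singleton v).union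
      (Set.Finite.biUnion ((hfin v).subset (Set.sep_subset _ _)) ?_)) hsub
    rintro u ⟨hu, hd⟩
    by_contra hinf
    exact hcon ⟨u, hinf⟩ hu hd
  choose f hf using step
  have h0 : (D ρ).Infinite := by
    have : D ρ = Set.univ := by ext w; simp [D]
    rw [this]; exact Set.infinite_univ
  let γ : ℕ → {v // (D v).Infinite} := fun n => f^[n] ⟨ρ, h0⟩
  have hs : ∀ n, γ (n + 1) = f (γ n) := fun n => Function.iterate_succ_apply' f n _
  have hd : ∀ n, G.dist ρ (γ n).1 = n := by
    intro n
    induction n with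
    | zero => simp [γ]
    | succ n ih => rw [hs, (hf _).2, ih]
  refine ⟨fun n => (γ n).1, rfl, fun n => ?_, fun m n hmn => ?_⟩
  · show G.Adj (γ n).1 (γ (n + 1)).1
    rw [hs]; exact (hf _).1
  · have : G.dist ρ (γ m).1 = G.dist ρ (γ n).1 := congrArg _ hmn
    rwa [hd, hd] at this

/-- The inside of a cutset is finite, so the sums and products over configurations below are
genuine finite sums and products. -/
theorem finite_insClosure {V : Type*} (G : SimpleGraph V) (hdeg : BoundedDegree G) (ρ : V)
    (S : Finset V) (hS : IsCutset G ρ S) : (InsClosure G ρ S).Finite := by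
  refine Set.Finite.union ?_ S.finite_toSet
  by_contra hinf
  have : Infinite (Ins G ρ S) := Set.infinite_coe_iff.2 hinf
  obtain ⟨x₀, p₀, hp₀⟩ : (Ins G ρ S).Nonempty := Set.Infinite.nonempty hinf
  have hρ : ρ ∈ Ins G ρ S :=
    ⟨.nil, by simpa using hp₀ ρ p₀.start_mem_support⟩
  have hreach : ∀ x : Ins G ρ S, (G.induce (Ins G ρ S)).Reachable ⟨ρ, hρ⟩ x := by
    classical
    rintro ⟨x, p, hp⟩
    have hin : ∀ z ∈ p.support, z ∈ Ins G ρ S := fun z hz =>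
      ⟨p.takeUntil z hz, fun y hy => hp y (p.support_takeUntil_subset_support hz hy)⟩
    exact ⟨p.induce _ hin⟩
  have hconn : (G.induce (Ins G ρ S)).Connected :=
    { preconnected := fun x y => (hreach x).symm.trans (hreach y)
      nonempty := ⟨⟨ρ, hρ⟩⟩ }
  obtain ⟨K, hK⟩ := hdeg
  obtain ⟨γ, h0, hadj, hinj⟩ := exists_isRay _ hconn (fun x => by
    have hx : (G.neighborSet x.1).Finite :=
      Set.encard_lt_top_iff.1 ((hK x.1).trans_lt (ENat.natCast_lt_top K))
    exact (hx.preimage Subtype.val_injective.injOn).subset fun y hy => hy) ⟨ρ, hρ⟩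
  obtain ⟨n, hn⟩ := hS (fun n => (γ n).1)
    ⟨by simp [h0], fun n => hadj n, fun m n h => hinj (Subtype.ext h)⟩
  obtain ⟨p, hp⟩ := (γ n).2
  exact hp _ p.end_mem_support hn

/-! ### Markov chains -/

/-- `M` is the transition matrix of an ergodic finite Markov chain: it is stochastic, irreducible,
and aperiodic (for every state, the only common divisor of its possible return times is `1`). -/
def IsErgodicChain {A : Type*} [Fintype A] [DecidableEq A] (M : Matrix A A ℝ) : Prop :=
  M ∈ Matrix.rowStochastic ℝ A ∧ M.IsIrreducible ∧
  (∀ i, ∀ d : ℕ, (∀ n : ℕ, 0 < (M ^ n) i i → d ∣ n) → d = 1)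

/-- `|λ₂(M)|`: list the absolute values of the complex eigenvalues of `M` (with algebraic
multiplicity) in decreasing order, and take the second one (and `0` if `M` has no second
eigenvalue, that is, if there is at most one state). -/
noncomputable def absSecondEigenvalue {A : Type*} [Fintype A] [DecidableEq A]
    (M : Matrix A A ℝ) : ℝ :=
  (((M.map (algebraMap ℝ ℂ)).charpoly.roots.map (fun z : ℂ => ‖z‖)).sort (· ≥ ·)).getD 1 0

open Classical in
/-- The weight of a configuration `σ` of states on the closed inside of `S` and of observed states
`τ` on `S`, for the chain with transition matrix `M` started from the state `l` at the root and
observed on `S` through the stochastic matrix `N`: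
`1{σ(ρ) = l} ∏_{(x,y) edge inside S} M_{σ(x),σ(y)} ∏_{y ∈ S} N_{σ(y),τ(y)}`. -/
noncomputable def jointWeight {V A B : Type*} (G : SimpleGraph V) (ρ : V) (S : Finset V)
    (M : Matrix A A ℝ) (N : Matrix A B ℝ) (l : A)
    (σ : InsClosure G ρ S → A) (τ : S → B) : ℝ :=
  (if σ ⟨ρ, root_mem_insClosure G ρ S⟩ = l then 1 else 0) *
  (∏ᶠ e : InsClosure G ρ S × InsClosure G ρ S,
    if (e.1 : V) ∈ Ins G ρ S ∧ IsChild G ρ e.1 e.2 then M (σ e.1) (σ e.2) else 1) *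
  ∏ y : S, N (σ ⟨y, Or.inr y.2⟩) (τ y)

/-- The distribution on `S → B` of the observed states on `S`, started from the state `l` at the
root: the sum of the joint weights over all configurations of states. -/
noncomputable def observedLaw {V A B : Type*} (G : SimpleGraph V) (ρ : V) (S : Finset V)
    (M : Matrix A A ℝ) (N : Matrix A B ℝ) (l : A) (τ : S → B) : ℝ :=
  ∑ᶠ σ : InsClosure G ρ S → A, jointWeight G ρ S M N l σ τ

/-- Total variation distance of two distributions on a finite space. -/
noncomputable def tvDist {Ω : Type*} [Fintype Ω] (μ ν : Ω → ℝ) : ℝ :=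
  1 / 2 * ∑ ω, |μ ω - ν ω|

open Classical in
/-- For some pair of root states `i`, `j`, the infimum over antichains `S` of the total variation
distance between the laws on `S`, observed through `N`, of the chains started from `i` and from `j`
is positive. -/
def SolvableThrough {V A B : Type*} [Fintype B] (G : SimpleGraph V) (ρ : V)
    (M : Matrix A A ℝ) (N : Matrix A B ℝ) : Prop :=
  ∃ i j : A, 0 < ⨅ S : {S : Finset V // IsAntichainCutset G ρ S},
    tvDist (observedLaw G ρ S.1 M N i) (observedLaw G ρ S.1 M N j)

/-- A distribution on `A` that gives positive mass to every point. -/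
def IsNondegenerateDistribution {A : Type*} [Fintype A] (ν : A → ℝ) : Prop :=
  (∀ i, 0 < ν i) ∧ ∑ i, ν i = 1

/-- With probability `1 - ε` the state is observed, otherwise an independent sample from `ν`. -/
def resamplingNoise {A : Type*} [DecidableEq A] (ν : A → ℝ) (ε : ℝ) : Matrix A A ℝ :=
  Matrix.of fun i j => (1 - ε) * (if i = j then 1 else 0) + ε * ν j

/-- With probability `ε` the state is erased (`none` is observed), otherwise it is observed. -/
def erasureNoise (A : Type*) [DecidableEq A] (ε : ℝ) : Matrix A (Option A) ℝ :=
  Matrix.of fun i j => j.elim ε fun j => if i = j then 1 - ε else 0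

/-- Solvable through `k` additional steps of the chain at each observed vertex, for every `k`. -/
def RobustSolvable {V A : Type*} [Fintype A] [DecidableEq A] (G : SimpleGraph V) (ρ : V)
    (M : Matrix A A ℝ) : Prop :=
  ∀ k : ℕ, SolvableThrough G ρ M (M ^ k)

/-- Solvable through resampling from `ν` with every probability less than one. -/
def NuRobustSolvable {V A : Type*} [Fintype A] [DecidableEq A] (G : SimpleGraph V) (ρ : V)
    (M : Matrix A A ℝ) (ν : A → ℝ) : Prop :=
  ∀ ε : ℝ, 0 ≤ ε → ε < 1 → SolvableThrough G ρ M (resamplingNoise ν ε)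

/-- Solvable through erasure with every probability less than one. -/
def ErasureRobustSolvable {V A : Type*} [Fintype A] [DecidableEq A] (G : SimpleGraph V) (ρ : V)
    (M : Matrix A A ℝ) : Prop :=
  ∀ ε : ℝ, 0 ≤ ε → ε < 1 → SolvableThrough G ρ M (erasureNoise A ε)

/-!
# Non-reconstruction below the second eigenvalue threshold

Let `π` be the stationary law of `M`.  For the family of laws `(μ_i)` of an observation given the
hidden state `i`, the information it carries is measured by the chi-square quantity
`X = ∑ ‖ℓ (μ (τ))‖² / (π ⬝ μ (τ))`, summed over the observed values `τ`, where `ℓ` is a linear map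
to an inner product space that kills constants (`IsContrast`, `chiSq`).  Total variation distances
are at most `√X`.

* One step of the chain replaces `μ` by `M μ` and does not change the denominator since `π M = π`.
  For any `s > |λ₂(M)|` there is a contrast with `‖ℓ (M v)‖ ≤ s ‖ℓ v‖` (`exists_contrast`): deflate
  the eigenvalue one, use Gelfand's formula, and stack finitely many rescaled powers.  So a step
  multiplies `X` by at most `s²` (`IsContrast.chiSq_mulVec_le`).
* Observations below different children are conditionally independent, so their likelihoods
  multiply.  Since deviations from `π`-means average to zero, `X` is subadditive up to third order
  terms: if both values are at most `δ`, the loss is a factor `1 + C √δ`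
  (`IsContrast.expect_chiSq_mul_le`).  Likelihood ratios against the stationary mixture are bounded
  by `1 / π_i`, so no positivity of `M` is needed.

Choose `θ` with `|λ₂|² < s² < θ` and cutsets of arbitrarily small weight `∑ θ ^ |x|`; this is what
`br(T) |λ₂|² < 1` provides.  Replacing a cutset by one of minimal weight among its ancestors makes
it an antichain whose portion below any vertex `v` weighs at most `θ ^ |v|`
(`exists_isAntichainCutset_sum_le`).  If single observations have chi-square at most a small `δ`,
then by induction from the leaves the chi-square at `v` is at most `δ` times the relative weight of
the portion below `v`; it therefore never exceeds `δ`, the loss factors stay under control, and at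
the root it is `δ ∑ θ ^ |x|`, as small as desired (`IsForest.expect_chiSq_likelihood_le`,
`not_solvableThrough`).  Each of the three kinds of noise makes the chi-square of a single
observation arbitrarily small.

Sums over configurations and observations are handled as uniform averages over all functions
(`𝔼`), so that independence amounts to dependence on disjoint sets of coordinates
(`expect_mul_of_dependsOn`).
-/

open scoped BigOperators InnerProductSpace Matrix

/-! ### The chi-square functional and its behaviour under independent products -/

/-- `ℓ` is a contrast relative to the distribution `π`: a linear map to an inner product space that
kills the constant vectors and controls the deviation of a vector from its `π`-mean. -/
structure IsContrast {A H : Type*} [Fintype A] [NormedAddCommGroup H] [InnerProductSpace ℝ H]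
    (π : A → ℝ) (ℓ : (A → ℝ) →ₗ[ℝ] H) : Prop where
  pos : ∀ i, 0 < π i
  sum_eq_one : ∑ i, π i = 1
  map_one : ℓ 1 = 0
  abs_sub_le : ∀ v i, |v i - π ⬝ᵥ v| ≤ ‖ℓ v‖

/-- The chi-square density `‖ℓ z‖² / (π ⬝ z)` of a vector `z` of likelihoods (indexed by the hidden
state).  It is homogeneous of degree one, and it is `0` at `z = 0` by the convention `x / 0 = 0`. -/
noncomputable def chiSq {A H : Type*} [Fintype A] [NormedAddCommGroup H] [InnerProductSpace ℝ H]
    (π : A → ℝ) (ℓ : (A → ℝ) →ₗ[ℝ] H) (z : A → ℝ) : ℝ :=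
  ‖ℓ z‖ ^ 2 / (π ⬝ᵥ z)

section Contrast

variable {A H : Type*} [Fintype A] [NormedAddCommGroup H] [InnerProductSpace ℝ H]
  {π : A → ℝ} {ℓ : (A → ℝ) →ₗ[ℝ] H}

theorem exists_norm_le_of_pi (ℓ : (A → ℝ) →ₗ[ℝ] H) :
    ∃ Λ : ℝ, 0 ≤ Λ ∧ ∀ v, ‖ℓ v‖ ≤ Λ * ‖v‖ := by
  obtain ⟨L, hL⟩ : ∃ L : (A → ℝ) →L[ℝ] H, ∀ v, L v = ℓ v :=
    ⟨⟨ℓ, ℓ.continuous_of_finiteDimensional⟩, fun _ => rfl⟩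
  exact ⟨‖L‖, norm_nonneg _, fun v => by rw [← hL]; exact L.le_opNorm v⟩

theorem IsContrast.dotProduct_nonneg (h : IsContrast π ℓ) {z : A → ℝ} (hz : ∀ i, 0 ≤ z i) :
    0 ≤ π ⬝ᵥ z :=
  Finset.sum_nonneg fun i _ => mul_nonneg (h.pos i).le (hz i)

theorem IsContrast.chiSq_nonneg (h : IsContrast π ℓ) {z : A → ℝ} (hz : ∀ i, 0 ≤ z i) :
    0 ≤ chiSq π ℓ z :=
  div_nonneg (sq_nonneg _) (h.dotProduct_nonneg hz)

theorem IsContrast.eq_zero_of_dotProduct_eq_zero (h : IsContrast π ℓ) {z : A → ℝ}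
    (hz : ∀ i, 0 ≤ z i) (h0 : π ⬝ᵥ z = 0) : z = 0 := by
  funext i
  have := (Finset.sum_eq_zero_iff_of_nonneg
    (fun i _ => mul_nonneg (h.pos i).le (hz i))).1 h0 i (Finset.mem_univ i)
  simpa [(h.pos i).ne'] using this

theorem IsContrast.chiSq_mul_dotProduct (h : IsContrast π ℓ) {z : A → ℝ} (hz : ∀ i, 0 ≤ z i) :
    chiSq π ℓ z * (π ⬝ᵥ z) = ‖ℓ z‖ ^ 2 := by
  by_cases h0 : π ⬝ᵥ z = 0
  · simp [h.eq_zero_of_dotProduct_eq_zero hz h0]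
  · exact div_mul_cancel₀ _ h0

theorem chiSq_smul (c : ℝ) (hc : 0 ≤ c) (z : A → ℝ) : chiSq π ℓ (c • z) = c * chiSq π ℓ z := by
  rcases hc.eq_or_lt with rfl | hc
  · simp [chiSq]
  · simp only [chiSq, map_smul, norm_smul, dotProduct_smul, smul_eq_mul, Real.norm_eq_abs,
      abs_of_pos hc]
    rw [mul_pow, pow_two c, mul_assoc, mul_div_mul_left _ _ hc.ne', mul_div_assoc]

theorem norm_pi_le {B : ℝ} (hB : 0 ≤ B) {v : A → ℝ} (hv : ∀ i, |v i| ≤ B) : ‖v‖ ≤ B :=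
  (pi_norm_le_iff_of_nonneg hB).2 hv

/-- The product estimate for likelihood vectors of `π`-mean one.  The error terms are of third order
in the deviations; the denominator costs nothing because `u / (π ⬝ u)` is bounded for `u ≥ 0`. -/
theorem IsContrast.exists_chiSq_mul_le_of_mean_one (h : IsContrast π ℓ) :
    ∃ C : ℝ, 0 ≤ C ∧ ∀ a b : A → ℝ, (∀ i, 0 ≤ a i) → (∀ i, 0 ≤ b i) →
      π ⬝ᵥ a = 1 → π ⬝ᵥ b = 1 →
      chiSq π ℓ (a * b) ≤ ‖ℓ a + ℓ b‖ ^ 2 + C * (‖ℓ a‖ ^ 2 * ‖ℓ b‖ + ‖ℓ a‖ * ‖ℓ b‖ ^ 2) := by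
  obtain ⟨Λ, hΛ, hℓ⟩ := exists_norm_le_of_pi ℓ
  set B : ℝ := ∑ i, (π i)⁻¹ with hBdef
  have hB0 : 0 ≤ B := Finset.sum_nonneg fun i _ => inv_nonneg.2 (h.pos i).le
  have hle : ∀ z : A → ℝ, (∀ i, 0 ≤ z i) → ∀ i, z i ≤ B * (π ⬝ᵥ z) := by
    intro z hz i
    have h1 : π i * z i ≤ π ⬝ᵥ z :=
      Finset.single_le_sum (f := fun i => π i * z i)
        (fun i _ => mul_nonneg (h.pos i).le (hz i)) (Finset.mem_univ i)
    have h2 : (π i)⁻¹ ≤ B :=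
      Finset.single_le_sum (f := fun i => (π i)⁻¹)
        (fun i _ => inv_nonneg.2 (h.pos i).le) (Finset.mem_univ i)
    calc z i = (π i)⁻¹ * (π i * z i) := by rw [inv_mul_cancel_left₀ (h.pos i).ne']
      _ ≤ B * (π ⬝ᵥ z) := mul_le_mul h2 h1 (mul_nonneg (h.pos i).le (hz i)) hB0
  have hnorm : ∀ z : A → ℝ, (∀ i, 0 ≤ z i) → ‖ℓ z‖ ≤ Λ * B * (π ⬝ᵥ z) := by
    intro z hz
    rw [mul_assoc]
    refine (hℓ z).trans (mul_le_mul_of_nonneg_left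
      (norm_pi_le (mul_nonneg hB0 (h.dotProduct_nonneg hz)) fun i => ?_) hΛ)
    rw [abs_of_nonneg (hz i)]
    exact hle z hz i
  refine ⟨2 * Λ + Λ ^ 3 * B + (1 + Λ ^ 2 * B) * (Λ * B), by positivity, ?_⟩
  intro a b ha hb ha1 hb1
  set x := ℓ a
  set y := ℓ b
  set w := ℓ ((a - 1) * (b - 1)) with hw
  set t := π ⬝ᵥ (a * b) with ht
  have hab : ∀ i, 0 ≤ (a * b) i := fun i => mul_nonneg (ha i) (hb i)
  have ht0 : 0 ≤ t := h.dotProduct_nonneg hab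
  have hdev : ∀ i, |((a - 1) * (b - 1)) i| ≤ ‖x‖ * ‖y‖ := by
    intro i
    have h1 := h.abs_sub_le a i
    have h2 := h.abs_sub_le b i
    rw [ha1] at h1
    rw [hb1] at h2
    simpa [abs_mul] using mul_le_mul h1 h2 (abs_nonneg _) (norm_nonneg _)
  have hwle : ‖w‖ ≤ Λ * (‖x‖ * ‖y‖) :=
    (hℓ _).trans (mul_le_mul_of_nonneg_left (norm_pi_le (by positivity) hdev) hΛ)
  have hsplit : a * b = (a - 1) * (b - 1) + (a + b) - 1 := by ring
  have hu : ℓ (a * b) = x + y + w := by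
    rw [hsplit, map_sub, map_add, map_add, h.map_one]
    simp only [sub_zero]
    exact add_comm _ _
  have ht1 : |1 - t| ≤ ‖x‖ * ‖y‖ := by
    have hπ1 : π ⬝ᵥ (1 : A → ℝ) = 1 := by simpa [dotProduct] using h.sum_eq_one
    have : t - 1 = π ⬝ᵥ ((a - 1) * (b - 1)) := by
      rw [ht, hsplit, dotProduct_sub, dotProduct_add, dotProduct_add, ha1, hb1, hπ1]
      ring
    rw [abs_sub_comm, this]
    calc |π ⬝ᵥ ((a - 1) * (b - 1))| ≤ ∑ i, |π i * ((a - 1) * (b - 1)) i| :=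
          Finset.abs_sum_le_sum_abs _ _
      _ ≤ ∑ i, π i * (‖x‖ * ‖y‖) := Finset.sum_le_sum fun i _ => by
          rw [abs_mul, abs_of_pos (h.pos i)]
          exact mul_le_mul_of_nonneg_left (hdev i) (h.pos i).le
      _ = ‖x‖ * ‖y‖ := by rw [← Finset.sum_mul, h.sum_eq_one, one_mul]
  have hx : ‖x‖ ≤ Λ * B := by simpa [ha1] using hnorm a ha
  have hu2 : ‖x + y + w‖ ≤ (1 + Λ ^ 2 * B) * (‖x‖ + ‖y‖) := by
    have h1 : ‖x + y + w‖ ≤ ‖x‖ + ‖y‖ + ‖w‖ := norm_add₃_le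
    have h2 : Λ * (‖x‖ * ‖y‖) ≤ Λ * ((Λ * B) * ‖y‖) := by gcongr
    have h3 : 0 ≤ Λ ^ 2 * B * ‖x‖ := by positivity
    nlinarith
  have hw2 : ‖w‖ ≤ Λ ^ 2 * B * (‖x‖ + ‖y‖) := by
    have h2 : Λ * (‖x‖ * ‖y‖) ≤ Λ * ((Λ * B) * ‖y‖) := by gcongr
    have h3 : 0 ≤ Λ ^ 2 * B * ‖x‖ := by positivity
    nlinarith
  have hsq : ‖x + y + w‖ ^ 2 ≤ ‖x + y‖ ^ 2 +
      (2 * Λ + Λ ^ 3 * B) * (‖x‖ * ‖y‖) * (‖x‖ + ‖y‖) := by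
    rw [norm_add_sq_real (x + y) w]
    have h1 : ⟪x + y, w⟫_ℝ ≤ (‖x‖ + ‖y‖) * (Λ * (‖x‖ * ‖y‖)) :=
      (real_inner_le_norm _ _).trans
        (mul_le_mul (norm_add_le _ _) hwle (norm_nonneg _) (by positivity))
    have h2 : ‖w‖ ^ 2 ≤ (Λ * (‖x‖ * ‖y‖)) * (Λ ^ 2 * B * (‖x‖ + ‖y‖)) := by
      rw [pow_two]
      exact mul_le_mul hwle hw2 (norm_nonneg _) (by positivity)
    nlinarith
  have hdiv : chiSq π ℓ (a * b) ≤ ‖x + y + w‖ ^ 2 +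
      (‖x‖ * ‖y‖) * ((Λ * B) * ‖x + y + w‖) := by
    rw [chiSq, hu, ← ht]
    rcases ht0.eq_or_lt with h0 | h0
    · rw [← h0, div_zero]
      positivity
    · -- `q / t = q + (1 - t) q / t`, where `1 - t` is already of second order
      have hu3 : ‖x + y + w‖ / t ≤ Λ * B := by
        rw [div_le_iff₀ h0, ← hu]
        exact hnorm _ hab
      have e : ‖x + y + w‖ ^ 2 / t =
          ‖x + y + w‖ ^ 2 + (1 - t) * ((‖x + y + w‖ / t) * ‖x + y + w‖) := by
        field_simp
        ring
      rw [e]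
      gcongr
      exact (le_abs_self _).trans ht1
  have hlast : (‖x‖ * ‖y‖) * ((Λ * B) * ‖x + y + w‖) ≤
      (‖x‖ * ‖y‖) * ((Λ * B) * ((1 + Λ ^ 2 * B) * (‖x‖ + ‖y‖))) := by gcongr
  calc chiSq π ℓ (a * b) ≤ _ := hdiv
    _ ≤ _ := add_le_add hsq hlast
    _ = _ := by ring

/-- The product estimate for arbitrary nonnegative likelihood vectors, in homogeneous form, with
third order constant `C`. -/
def HasProductConstant (π : A → ℝ) (ℓ : (A → ℝ) →ₗ[ℝ] H) (C : ℝ) : Prop :=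
  ∀ a b : A → ℝ, (∀ i, 0 ≤ a i) → (∀ i, 0 ≤ b i) →
    chiSq π ℓ (a * b) ≤ chiSq π ℓ a * (π ⬝ᵥ b) + (π ⬝ᵥ a) * chiSq π ℓ b + 2 * ⟪ℓ a, ℓ b⟫_ℝ +
      C * (chiSq π ℓ a * ‖ℓ b‖ + ‖ℓ a‖ * chiSq π ℓ b)

theorem IsContrast.exists_hasProductConstant (h : IsContrast π ℓ) :
    ∃ C : ℝ, 0 ≤ C ∧ HasProductConstant π ℓ C := by
  obtain ⟨C, hC, hmain⟩ := h.exists_chiSq_mul_le_of_mean_one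
  refine ⟨C, hC, fun a b ha hb => ?_⟩
  by_cases ha0 : π ⬝ᵥ a = 0
  · rw [h.eq_zero_of_dotProduct_eq_zero ha ha0]
    simp [chiSq]
  by_cases hb0 : π ⬝ᵥ b = 0
  · rw [h.eq_zero_of_dotProduct_eq_zero hb hb0]
    simp [chiSq]
  obtain ⟨a', α, hα, rfl, ha1⟩ : ∃ (a' : A → ℝ) (α : ℝ), 0 < α ∧ a = α • a' ∧ π ⬝ᵥ a' = 1 :=
    ⟨(π ⬝ᵥ a)⁻¹ • a, _, lt_of_le_of_ne (h.dotProduct_nonneg ha) (Ne.symm ha0), by rw [smul_inv_smul₀ ha0], by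
      rw [dotProduct_smul, smul_eq_mul, inv_mul_cancel₀ ha0]⟩
  obtain ⟨b', β, hβ, rfl, hb1⟩ : ∃ (b' : A → ℝ) (β : ℝ), 0 < β ∧ b = β • b' ∧ π ⬝ᵥ b' = 1 :=
    ⟨(π ⬝ᵥ b)⁻¹ • b, _, lt_of_le_of_ne (h.dotProduct_nonneg hb) (Ne.symm hb0), by rw [smul_inv_smul₀ hb0], by
      rw [dotProduct_smul, smul_eq_mul, inv_mul_cancel₀ hb0]⟩
  have key := hmain a' b' (fun i => nonneg_of_mul_nonneg_right (ha i) hα)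
    (fun i => nonneg_of_mul_nonneg_right (hb i) hβ) ha1 hb1
  have e : α • a' * β • b' = (α * β) • (a' * b') := by
    rw [smul_mul_smul_comm]
  have ca : chiSq π ℓ a' = ‖ℓ a'‖ ^ 2 := by rw [chiSq, ha1, div_one]
  have cb : chiSq π ℓ b' = ‖ℓ b'‖ ^ 2 := by rw [chiSq, hb1, div_one]
  rw [e, chiSq_smul _ (by positivity), chiSq_smul _ hα.le, chiSq_smul _ hβ.le, map_smul, map_smul,
    dotProduct_smul, dotProduct_smul, ha1, hb1, norm_smul, norm_smul, real_inner_smul_left,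
    real_inner_smul_right, Real.norm_of_nonneg hα.le, Real.norm_of_nonneg hβ.le, ca, cb]
  rw [norm_add_sq_real] at key
  have := mul_le_mul_of_nonneg_left key (mul_pos hα hβ).le
  simp only [smul_eq_mul, mul_one]
  linarith

theorem IsContrast.expect_dotProduct (h : IsContrast π ℓ) {Ω : Type*} [Fintype Ω]
    {z : Ω → A → ℝ} (hz : ∀ i, 𝔼 ω, z ω i = 1) : 𝔼 ω, π ⬝ᵥ z ω = 1 := by
  simp only [dotProduct]
  rw [Finset.expect_sum_comm]
  simp_rw [← Finset.mul_expect, hz, mul_one]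
  exact h.sum_eq_one

/-- Cauchy-Schwarz: the mean size of the contrast is at most the root of the chi-square. -/
theorem IsContrast.expect_norm_le (h : IsContrast π ℓ) {Ω : Type*} [Fintype Ω] [Nonempty Ω]
    {a : Ω → A → ℝ} (ha : ∀ ω i, 0 ≤ a ω i) (hmean : ∀ i, 𝔼 ω, a ω i = 1) :
    𝔼 ω, ‖ℓ (a ω)‖ ≤ √(𝔼 ω, chiSq π ℓ (a ω)) := by
  have hdot := h.expect_dotProduct hmean
  refine Real.le_sqrt_of_sq_le ?_
  have := Finset.expect_mul_sq_le_sq_mul_sq Finset.univ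
    (fun ω => √(chiSq π ℓ (a ω))) (fun ω => √(π ⬝ᵥ a ω))
  calc (𝔼 ω, ‖ℓ (a ω)‖) ^ 2 = (𝔼 ω, √(chiSq π ℓ (a ω)) * √(π ⬝ᵥ a ω)) ^ 2 := by
        congr 1
        refine Finset.expect_congr rfl fun ω _ => ?_
        rw [← Real.sqrt_mul (h.chiSq_nonneg (ha ω)), h.chiSq_mul_dotProduct (ha ω),
          Real.sqrt_sq (norm_nonneg _)]
    _ ≤ _ := this
    _ = 𝔼 ω, chiSq π ℓ (a ω) := by
        simp_rw [Real.sq_sqrt (h.chiSq_nonneg (ha _)), Real.sq_sqrt (h.dotProduct_nonneg (ha _))]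
        rw [hdot, mul_one]

/-- The chi-square of a pair of independent observations is subadditive up to a factor close to one
when both are small: the inner product term of the pointwise estimate averages to
`⟪ℓ 1, ℓ 1⟫ = 0`, and the error terms factor. -/
theorem IsContrast.expect_chiSq_mul_le (h : IsContrast π ℓ) {C : ℝ} (hC : 0 ≤ C)
    (hmul : HasProductConstant π ℓ C) {Ω : Type*} [Fintype Ω] [Nonempty Ω] {a b : Ω → A → ℝ}
    {δ : ℝ} (ha : ∀ ω i, 0 ≤ a ω i) (hb : ∀ ω i, 0 ≤ b ω i)
    (ha1 : ∀ i, 𝔼 ω, a ω i = 1) (hb1 : ∀ i, 𝔼 ω, b ω i = 1)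
    (hind : ∀ F F' : (A → ℝ) → ℝ,
      𝔼 ω, F (a ω) * F' (b ω) = (𝔼 ω, F (a ω)) * 𝔼 ω, F' (b ω))
    (hXδ : 𝔼 ω, chiSq π ℓ (a ω) ≤ δ) (hYδ : 𝔼 ω, chiSq π ℓ (b ω) ≤ δ) :
    𝔼 ω, chiSq π ℓ (a ω * b ω) ≤
      (1 + C * √δ) * (𝔼 ω, chiSq π ℓ (a ω) + 𝔼 ω, chiSq π ℓ (b ω)) := by
  classical
  have hinner : 𝔼 ω, ⟪ℓ (a ω), ℓ (b ω)⟫_ℝ = 0 := by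
    set e : A → H := fun i => ℓ (fun j => if i = j then 1 else 0)
    have h1 : ∀ z : A → ℝ, ℓ z = ∑ i, z i • e i := fun z => ℓ.pi_apply_eq_sum_univ z
    have h2 : ∀ i j, 𝔼 ω, a ω i * b ω j = 1 := fun i j => by
      rw [hind (fun z => z i) (fun z => z j), ha1, hb1, one_mul]
    calc 𝔼 ω, ⟪ℓ (a ω), ℓ (b ω)⟫_ℝ
        = 𝔼 ω, ∑ i, ∑ j, a ω i * b ω j * ⟪e i, e j⟫_ℝ := by
          refine Finset.expect_congr rfl fun ω _ => ?_
          rw [h1 (a ω), h1 (b ω), sum_inner]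
          refine Finset.sum_congr rfl fun i _ => ?_
          rw [inner_sum]
          refine Finset.sum_congr rfl fun j _ => ?_
          rw [real_inner_smul_left, real_inner_smul_right, mul_assoc]
      _ = ∑ i, ∑ j, ⟪e i, e j⟫_ℝ := by
          rw [Finset.expect_sum_comm]
          refine Finset.sum_congr rfl fun i _ => ?_
          rw [Finset.expect_sum_comm]
          refine Finset.sum_congr rfl fun j _ => ?_
          rw [← Finset.expect_mul, h2, one_mul]
      _ = ⟪ℓ 1, ℓ 1⟫_ℝ := by
          rw [h1 1, sum_inner]
          simp [inner_sum]
      _ = 0 := by rw [h.map_one, inner_zero_left]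
  set X := 𝔼 ω, chiSq π ℓ (a ω) with hX
  set Y := 𝔼 ω, chiSq π ℓ (b ω) with hY
  have hX0 : 0 ≤ X := Finset.expect_nonneg fun ω _ => h.chiSq_nonneg (ha ω)
  have hY0 : 0 ≤ Y := Finset.expect_nonneg fun ω _ => h.chiSq_nonneg (hb ω)
  have hbound : 𝔼 ω, chiSq π ℓ (a ω * b ω) ≤
      X * (𝔼 ω, π ⬝ᵥ b ω) + (𝔼 ω, π ⬝ᵥ a ω) * Y + 2 * (𝔼 ω, ⟪ℓ (a ω), ℓ (b ω)⟫_ℝ) +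
        C * (X * (𝔼 ω, ‖ℓ (b ω)‖) + (𝔼 ω, ‖ℓ (a ω)‖) * Y) := by
    rw [hX, hY, ← hind (chiSq π ℓ) (fun z => π ⬝ᵥ z), ← hind (fun z => π ⬝ᵥ z) (chiSq π ℓ),
      ← hind (chiSq π ℓ) (fun z => ‖ℓ z‖), ← hind (fun z => ‖ℓ z‖) (chiSq π ℓ),
      Finset.mul_expect, ← Finset.expect_add_distrib, ← Finset.expect_add_distrib,
      ← Finset.expect_add_distrib, Finset.mul_expect, ← Finset.expect_add_distrib]
    exact Finset.expect_le_expect fun ω _ => hmul _ _ (ha ω) (hb ω)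
  rw [h.expect_dotProduct ha1, h.expect_dotProduct hb1, hinner] at hbound
  have hA : 𝔼 ω, ‖ℓ (a ω)‖ ≤ √δ := (h.expect_norm_le ha ha1).trans (Real.sqrt_le_sqrt hXδ)
  have hB : 𝔼 ω, ‖ℓ (b ω)‖ ≤ √δ := (h.expect_norm_le hb hb1).trans (Real.sqrt_le_sqrt hYδ)
  have h1 : X * (𝔼 ω, ‖ℓ (b ω)‖) ≤ X * √δ := mul_le_mul_of_nonneg_left hB hX0
  have h2 : (𝔼 ω, ‖ℓ (a ω)‖) * Y ≤ √δ * Y := mul_le_mul_of_nonneg_right hA hY0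
  have h3 := mul_le_mul_of_nonneg_left (add_le_add h1 h2) hC
  linarith

/-- A matrix that preserves the reference distribution and contracts the contrast contracts the
chi-square. -/
theorem IsContrast.chiSq_mulVec_le (h : IsContrast π ℓ) {M : Matrix A A ℝ} {r : ℝ}
    (hπ : π ᵥ* M = π) (hM : ∀ v, ‖ℓ (M *ᵥ v)‖ ≤ r * ‖ℓ v‖) {z : A → ℝ} (hz : ∀ i, 0 ≤ z i) :
    chiSq π ℓ (M *ᵥ z) ≤ r ^ 2 * chiSq π ℓ z := by
  rw [chiSq, chiSq, Matrix.dotProduct_mulVec, hπ, ← mul_div_assoc, ← mul_pow]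
  have := h.dotProduct_nonneg hz
  gcongr
  exact hM z

end Contrast

/-! ### Independence under uniform averages over a finite product -/

section Independence

variable {ι B : Type*} [Fintype ι] [DecidableEq ι] [Fintype B]

theorem DependsOn.comp_left {ι : Type*} {α : ι → Type*} {β γ : Type*} {f : (Π i, α i) → β}
    {s : Set ι} (hf : DependsOn f s) (g : β → γ) : DependsOn (fun x => g (f x)) s :=
  fun _ _ h => congrArg g (hf h)

open Classical in
/-- Functions of disjoint sets of coordinates are independent under the uniform average: exchanging
the coordinates in `s` of two independent copies is an involution. -/
theorem expect_mul_of_dependsOn {F F' : (ι → B) → ℝ} {s t : Set ι} (hF : DependsOn F s)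
    (hF' : DependsOn F' t) (hst : Disjoint s t) :
    𝔼 τ, F τ * F' τ = (𝔼 τ, F τ) * 𝔼 τ, F' τ := by
  cases isEmpty_or_nonempty (ι → B) with
  | inl h => simp
  | inr h =>
    let sw : (ι → B) × (ι → B) → (ι → B) × (ι → B) := fun p =>
      (s.piecewise p.1 p.2, s.piecewise p.2 p.1)
    have hsw : Function.Involutive sw := by
      rintro ⟨a, b⟩
      refine Prod.ext (funext fun i => ?_) (funext fun i => ?_) <;>
      by_cases hi : i ∈ s <;> simp [sw, hi]
    calc 𝔼 τ, F τ * F' τ = 𝔼 τ, 𝔼 _τ' : ι → B, F τ * F' τ := by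
          simp_rw [Fintype.expect_const]
      _ = 𝔼 p : (ι → B) × (ι → B), F p.1 * F' p.1 := by
          rw [← Finset.univ_product_univ, Finset.expect_product]
      _ = 𝔼 p : (ι → B) × (ι → B), F p.1 * F' p.2 := by
          refine (Fintype.expect_bijective sw hsw.bijective _ _ ?_).symm
          rintro ⟨a, b⟩
          congr 1
          · exact hF fun i hi => by simp [sw, hi]
          · exact hF' fun i hi => by simp [sw, Set.disjoint_right.1 hst hi]
      _ = _ := by
          rw [← Finset.univ_product_univ, Finset.expect_product]
          simp_rw [← Finset.mul_expect, ← Finset.expect_mul]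

theorem dependsOn_finset_prod {ι κ : Type*} {α : ι → Type*} {F : κ → (Π i, α i) → ℝ}
    {D : κ → Set ι} {s : Finset κ} {t : Set ι} (hF : ∀ c ∈ s, DependsOn (F c) (D c))
    (hD : ∀ c ∈ s, D c ⊆ t) : DependsOn (fun τ => ∏ c ∈ s, F c τ) t :=
  fun _ _ h => Finset.prod_congr rfl fun c hc => hF c hc fun i hi => h i (hD c hc hi)

theorem expect_prod_of_dependsOn [Nonempty B] {κ : Type*} {F : κ → (ι → B) → ℝ}
    {D : κ → Set ι} (s : Finset κ) (hF : ∀ c ∈ s, DependsOn (F c) (D c))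
    (hD : (s : Set κ).PairwiseDisjoint D) :
    𝔼 τ, ∏ c ∈ s, F c τ = ∏ c ∈ s, 𝔼 τ, F c τ := by
  classical
  induction s using Finset.induction_on with
  | empty => simp
  | insert c s hc ih =>
    simp only [Finset.prod_insert hc]
    rw [expect_mul_of_dependsOn (hF c (Finset.mem_insert_self c s))
      (dependsOn_finset_prod (t := ⋃ c ∈ s, D c)
        (fun d hd => hF d (Finset.mem_insert_of_mem hd))
        fun d hd => Set.subset_biUnion_of_mem (u := D) hd), ih]
    · exact fun d hd => hF d (Finset.mem_insert_of_mem hd)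
    · exact hD.subset (by simp)
    · rw [Set.disjoint_iUnion₂_right]
      intro d hd
      exact hD (by simp) (by simp [hd]) (by rintro rfl; exact hc hd)

/-- A single coordinate is uniformly distributed under the uniform average. -/
theorem expect_apply_coord [Nonempty B] (y : ι) (f : B → ℝ) :
    𝔼 τ : ι → B, f (τ y) = 𝔼 b, f b := by
  have h1 : ∀ τ : ι → B, f (τ y) = ∏ x, if x = y then f (τ x) else 1 := fun τ => by
    rw [Finset.prod_ite_eq' Finset.univ y]; simp
  have h2 : ∑ τ : ι → B, f (τ y) = ∏ x, ∑ b, if x = y then f b else 1 := by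
    simp_rw [h1]
    rw [Finset.prod_univ_sum, Fintype.piFinset_univ]
  rw [Fintype.expect_eq_sum_div_card, Fintype.expect_eq_sum_div_card, h2,
    ← Finset.mul_prod_erase _ _ (Finset.mem_univ y), Finset.prod_congr rfl (g := fun _ => (Fintype.card B : ℝ))
      (fun x hx => by simp [Finset.ne_of_mem_erase hx]),
    Finset.prod_const, Finset.card_erase_of_mem (Finset.mem_univ y), Finset.card_univ]
  simp only [↓reduceIte]
  have hB : (Fintype.card B : ℝ) ≠ 0 := by simp
  have hι : Fintype.card ι - 1 + 1 = Fintype.card ι :=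
    Nat.sub_add_cancel (Fintype.card_pos_iff.2 ⟨y⟩)
  rw [Fintype.card_fun, Nat.cast_pow]
  nth_rewrite 2 [← hι]
  rw [pow_succ]
  field_simp

end Independence

/-! ### Independent families of observations -/

section Product

variable {A H : Type*} [Fintype A] [NormedAddCommGroup H] [InnerProductSpace ℝ H]
  {π : A → ℝ} {ℓ : (A → ℝ) →ₗ[ℝ] H} {ι B : Type*} [Fintype ι] [DecidableEq ι] [Fintype B]
  [Nonempty B]

/-- Approximate subadditivity of the chi-square for a finite family of independent observations. -/
theorem IsContrast.expect_chiSq_prod_le (h : IsContrast π ℓ) {C : ℝ} (hC : 0 ≤ C)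
    (hmul : HasProductConstant π ℓ C) {κ : Type*} {f : κ → (ι → B) → A → ℝ} {D : κ → Set ι}
    {δ : ℝ} (s : Finset κ) (hf : ∀ c ∈ s, ∀ τ i, 0 ≤ f c τ i)
    (hf1 : ∀ c ∈ s, ∀ i, 𝔼 τ, f c τ i = 1) (hdep : ∀ c ∈ s, DependsOn (f c) (D c))
    (hD : (s : Set κ).PairwiseDisjoint D)
    (hδ : (1 + C * √δ) ^ s.card * ∑ c ∈ s, 𝔼 τ, chiSq π ℓ (f c τ) ≤ δ) :
    𝔼 τ, chiSq π ℓ (∏ c ∈ s, f c τ) ≤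
      (1 + C * √δ) ^ s.card * ∑ c ∈ s, 𝔼 τ, chiSq π ℓ (f c τ) := by
  classical
  have hκ : 1 ≤ 1 + C * √δ := le_add_of_nonneg_right (by positivity)
  have hκ0 : 0 ≤ 1 + C * √δ := zero_le_one.trans hκ
  induction s using Finset.induction_on with
  | empty => simp [chiSq, h.map_one]
  | insert c s hc ih =>
    have hs : ∀ d ∈ s, d ∈ insert c s := fun d hd => Finset.mem_insert_of_mem hd
    have hcs : c ∈ insert c s := Finset.mem_insert_self c s
    have hX : ∀ d ∈ insert c s, 0 ≤ 𝔼 τ, chiSq π ℓ (f d τ) := fun d hd =>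
      Finset.expect_nonneg fun τ _ => h.chiSq_nonneg (hf d hd τ)
    have hS : 0 ≤ ∑ d ∈ s, 𝔼 τ, chiSq π ℓ (f d τ) := Finset.sum_nonneg fun d hd => hX d (hs d hd)
    have hpow : (1 + C * √δ) ^ s.card ≤ (1 + C * √δ) ^ (insert c s).card :=
      pow_le_pow_right₀ hκ (Finset.card_le_card (Finset.subset_insert c s))
    have hone : 1 ≤ (1 + C * √δ) ^ s.card := one_le_pow₀ hκ
    rw [Finset.sum_insert hc] at hδ ⊢
    have hsδ : (1 + C * √δ) ^ s.card * ∑ d ∈ s, 𝔼 τ, chiSq π ℓ (f d τ) ≤ δ :=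
      le_trans (mul_le_mul hpow (le_add_of_nonneg_left (hX c hcs)) hS (by positivity)) hδ
    have hcδ : 𝔼 τ, chiSq π ℓ (f c τ) ≤ δ := by
      refine le_trans ?_ hδ
      calc 𝔼 τ, chiSq π ℓ (f c τ) = 1 * 𝔼 τ, chiSq π ℓ (f c τ) := (one_mul _).symm
        _ ≤ _ := mul_le_mul (hone.trans hpow) (le_add_of_nonneg_right hS) (hX c hcs)
          (by positivity)
    have ihs := ih (fun d hd => hf d (hs d hd)) (fun d hd => hf1 d (hs d hd))
      (fun d hd => hdep d (hs d hd)) (hD.subset (by simp)) hsδ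
    have hdeps : DependsOn (fun τ => ∏ d ∈ s, f d τ) (⋃ d ∈ s, D d) := fun _ _ hτ =>
      Finset.prod_congr rfl fun d hd => hdep d (hs d hd) fun i hi =>
        hτ i (Set.mem_biUnion (Finset.mem_coe.2 hd) hi)
    have hdisj : Disjoint (D c) (⋃ d ∈ s, D d) := by
      rw [Set.disjoint_iUnion₂_right]
      intro d hd
      exact hD (by simp) (by simp [hd]) (by rintro rfl; exact hc hd)
    have hmain := h.expect_chiSq_mul_le hC hmul (a := f c) (b := fun τ => ∏ d ∈ s, f d τ) (δ := δ)
      (hf c hcs)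
      (fun τ i => by
        rw [Finset.prod_apply]
        exact Finset.prod_nonneg fun d hd => hf d (hs d hd) τ i)
      (hf1 c hcs)
      (fun i => by
        simp only [Finset.prod_apply]
        rw [expect_prod_of_dependsOn (D := D) s
          (fun d hd => (hdep d (hs d hd)).comp_left fun z => z i) (hD.subset (by simp))]
        exact Finset.prod_eq_one fun d hd => hf1 d (hs d hd) i)
      (fun F F' => expect_mul_of_dependsOn ((hdep c hcs).comp_left F) (hdeps.comp_left F') hdisj)
      hcδ (ihs.trans hsδ)
    simp only [Finset.prod_insert hc]
    calc _ ≤ _ := hmain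
      _ ≤ (1 + C * √δ) * ((1 + C * √δ) ^ s.card * (𝔼 τ, chiSq π ℓ (f c τ)) +
          (1 + C * √δ) ^ s.card * ∑ d ∈ s, 𝔼 τ, chiSq π ℓ (f d τ)) := by
        gcongr
        exact le_mul_of_one_le_left (hX c hcs) hone
      _ = _ := by rw [Finset.card_insert_of_notMem hc, pow_succ]; ring

end Product

/-! ### Markov chains on finite forests -/

/-- `r x y` says that `y` is a child of `x` in a forest: parents are unique, and the level `lev`
increases by one along each edge. -/
structure IsForest {W : Type*} (r : W → W → Prop) (lev : W → ℕ) : Prop where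
  unique : ∀ {x y z}, r x z → r y z → x = y
  lev_succ : ∀ {x y}, r x y → lev y = lev x + 1

section Forest

open Relation

variable {W : Type*} {r : W → W → Prop} {lev : W → ℕ}

theorem IsForest.lev_lt_of_transGen (h : IsForest r lev) {x y : W} (hxy : TransGen r x y) :
    lev x < lev y := by
  induction hxy with
  | single hb => rw [h.lev_succ hb]; exact Nat.lt_succ_self _
  | tail _ hb ih => rw [h.lev_succ hb]; omega

theorem IsForest.eq_of_reflTransGen (h : IsForest r lev) {x y z : W} (hxz : ReflTransGen r x z)
    (hyz : ReflTransGen r y z) (hlev : lev x = lev y) : x = y := by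
  have key : ∀ {x y : W}, ReflTransGen r x y → lev x = lev y → x = y := fun hxy hl => by
    rcases reflTransGen_iff_eq_or_transGen.1 hxy with e | ht
    · exact e.symm
    · exact absurd hl (h.lev_lt_of_transGen ht).ne
  have hr : Relator.RightUnique (Function.swap r) := fun a b c hb hc => h.unique hb hc
  rcases ReflTransGen.total_of_right_unique hr hxz.swap hyz.swap with h1 | h1
  · exact (key h1.swap hlev.symm).symm
  · exact key h1.swap hlev

theorem IsForest.pairwiseDisjoint (h : IsForest r lev) (v : W) :
    {c | r v c}.PairwiseDisjoint fun c => {y | ReflTransGen r c y} := by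
  intro c hc d hd hcd
  refine Set.disjoint_left.2 fun y hcy hdy => hcd (h.eq_of_reflTransGen hcy hdy ?_)
  rw [h.lev_succ hc, h.lev_succ hd]

theorem IsForest.pairwiseDisjoint_preimage {ι : Type*} (h : IsForest r lev) (e : ι → W) (v : W) :
    {c | r v c}.PairwiseDisjoint fun c => {y | ReflTransGen r c (e y)} :=
  fun _ hc _ hd hcd => (h.pairwiseDisjoint v hc hd hcd).preimage e

/-- Induction from the leaves of a finite forest towards the roots. -/
theorem IsForest.induction [Finite W] (h : IsForest r lev) {P : W → Prop}
    (ih : ∀ v, (∀ c, r v c → P c) → P v) (v : W) : P v := by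
  obtain ⟨H, hH⟩ := (Set.finite_range lev).bddAbove
  induction hk : H - lev v using Nat.strong_induction_on generalizing v with
  | _ k IH =>
    refine ih v fun c hc => IH (H - lev c) ?_ c rfl
    have h1 := h.lev_succ hc
    have h2 : lev c ≤ H := hH ⟨c, rfl⟩
    omega

end Forest

/-! ### Likelihoods and their recursion -/

section Likelihood

open Relation

open scoped Classical in
/-- The normalised likelihood of the observation `τ` at the vertex `v` in state `a`: it is
`|B| * N a (τ y)` if the observation labelled `y` is made at `v`, and `1` if there is none. -/
noncomputable def leafWeight {W A B ι : Type*} [Fintype B] [Fintype ι] (e : ι → W)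
    (N : Matrix A B ℝ) (v : W) (a : A) (τ : ι → B) : ℝ :=
  ∏ y, if e y = v then Fintype.card B * N a (τ y) else 1

open scoped Classical in
/-- The normalised transition weight `|A| * M (σ x) (σ y)` of the edge into `y` from its parent `x`,
and `1` if `y` has no parent. -/
noncomputable def edgeWeight {W A : Type*} [Fintype W] [Fintype A] (r : W → W → Prop)
    (M : Matrix A A ℝ) (y : W) (σ : W → A) : ℝ :=
  ∏ x, if r x y then Fintype.card A * M (σ x) (σ y) else 1

open scoped Classical in
/-- The normalised weight of the configuration `σ` and the observation `τ` on the descendants of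
`v` (the observation at `v` included). -/
noncomputable def subtreeWeight {W A B ι : Type*} [Fintype W] [Fintype A] [Fintype B] [Fintype ι]
    (r : W → W → Prop) (e : ι → W) (M : Matrix A A ℝ) (N : Matrix A B ℝ) (v : W) (σ : W → A)
    (τ : ι → B) : ℝ :=
  leafWeight e N v (σ v) τ *
    ∏ y with TransGen r v y, edgeWeight r M y σ * leafWeight e N y (σ y) τ

open scoped Classical in
/-- The likelihood of the observations made below `v`, given that the state at `v` is `i`, relative
to uniformly distributed observations.  All sums are written as uniform averages, so that the
coordinates outside the subtree of `v` do not matter. -/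
noncomputable def likelihood {W A B ι : Type*} [Fintype W] [Fintype A] [Fintype B] [Fintype ι]
    (r : W → W → Prop) (e : ι → W) (M : Matrix A A ℝ) (N : Matrix A B ℝ) (v : W) (τ : ι → B)
    (i : A) : ℝ :=
  𝔼 σ : W → A, (if σ v = i then (Fintype.card A : ℝ) else 0) * subtreeWeight r e M N v σ τ

variable {W A B ι : Type*} [Fintype B] [Fintype ι]
  {r : W → W → Prop} {lev : W → ℕ} {e : ι → W} {M : Matrix A A ℝ} {N : Matrix A B ℝ}

theorem dependsOn_leafWeight (v : W) (a : A) :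
    DependsOn (leafWeight e N v a) {y | ReflTransGen r v (e y)} := by
  classical
  intro τ τ' h
  refine Finset.prod_congr rfl fun y _ => ?_
  by_cases hy : e y = v
  · rw [if_pos hy, if_pos hy, h y (show ReflTransGen r v (e y) from hy ▸ .refl)]
  · rw [if_neg hy, if_neg hy]

theorem leafWeight_nonneg (hN : ∀ a b, 0 ≤ N a b) (v : W) (a : A) (τ : ι → B) :
    0 ≤ leafWeight e N v a τ := by
  classical
  refine Finset.prod_nonneg fun y _ => ?_
  split_ifs
  · exact mul_nonneg (Nat.cast_nonneg _) (hN _ _)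
  · exact zero_le_one

theorem leafWeight_eq (he : Function.Injective e) (y : ι) (a : A) (τ : ι → B) :
    leafWeight e N (e y) a τ = Fintype.card B * N a (τ y) := by
  classical
  rw [leafWeight, Finset.prod_eq_single y]
  · simp
  · intro x _ hx
    rw [if_neg (fun h => hx (he h))]
  · simp

theorem leafWeight_eq_one {v : W} (hv : v ∉ Set.range e) (a : A) (τ : ι → B) :
    leafWeight e N v a τ = 1 :=
  Finset.prod_eq_one fun y _ => if_neg fun h => hv ⟨y, h⟩

theorem expect_leafWeight [Nonempty B] [DecidableEq ι] (he : Function.Injective e)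
    (hN1 : ∀ a, ∑ b, N a b = 1)
    (v : W) (a : A) : 𝔼 τ, leafWeight e N v a τ = 1 := by
  by_cases hv : v ∈ Set.range e
  · obtain ⟨y, rfl⟩ := hv
    simp_rw [leafWeight_eq he]
    rw [expect_apply_coord y fun b => Fintype.card B * N a b, ← Finset.mul_expect,
      Fintype.card_mul_expect, hN1]
  · simp_rw [leafWeight_eq_one hv]
    exact Fintype.expect_const _

variable [Fintype W] [Fintype A]

theorem IsForest.edgeWeight_eq (h : IsForest r lev) {x y : W} (hxy : r x y) (σ : W → A) :
    edgeWeight r M y σ = Fintype.card A * M (σ x) (σ y) := by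
  classical
  rw [edgeWeight, Finset.prod_eq_single x]
  · rw [if_pos hxy]
  · intro z _ hz
    rw [if_neg (fun hzy => hz (h.unique hzy hxy))]
  · simp

theorem IsForest.subtreeWeight_eq (h : IsForest r lev) (v : W) (σ : W → A) (τ : ι → B)
    [DecidableRel r] :
    subtreeWeight r e M N v σ τ = leafWeight e N v (σ v) τ *
      ∏ c with r v c, (Fintype.card A * M (σ v) (σ c)) * subtreeWeight r e M N c σ τ := by
  classical
  have h1 : (Finset.univ.filter fun y => TransGen r v y) =
      (Finset.univ.filter fun c => r v c).biUnion
        fun c => Finset.univ.filter fun y => ReflTransGen r c y := by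
    ext y
    simp [TransGen.head'_iff]
  have h2 : ∀ c, (Finset.univ.filter fun y => ReflTransGen r c y) =
      insert c (Finset.univ.filter fun y => TransGen r c y) := by
    intro c
    ext y
    simp [reflTransGen_iff_eq_or_transGen]
  rw [subtreeWeight, h1, Finset.prod_biUnion]
  · congr 1
    refine Finset.prod_congr rfl fun c hc => ?_
    have hvc : r v c := (Finset.mem_filter.1 hc).2
    rw [h2, Finset.prod_insert, h.edgeWeight_eq hvc, subtreeWeight, mul_assoc]
    intro hcc
    exact (h.lev_lt_of_transGen (Finset.mem_filter.1 hcc).2).false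
  · intro c hc d hd hcd
    refine Finset.disjoint_left.2 fun y hy hy' => ?_
    exact Set.disjoint_left.1 (h.pairwiseDisjoint v (by simpa using hc) (by simpa using hd) hcd)
      (Finset.mem_filter.1 hy).2 (Finset.mem_filter.1 hy').2

theorem IsForest.dependsOn_subtreeWeight_left (h : IsForest r lev) (v : W) (τ : ι → B) :
    DependsOn (fun σ : W → A => subtreeWeight r e M N v σ τ) {y | ReflTransGen r v y} := by
  classical
  intro σ σ' hσ
  induction v using h.induction with
  | ih v ih =>
    beta_reduce
    rw [h.subtreeWeight_eq, h.subtreeWeight_eq, hσ v .refl]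
    congr 1
    refine Finset.prod_congr rfl fun c hc => ?_
    have hvc : r v c := (Finset.mem_filter.1 hc).2
    rw [hσ c (.single hvc)]
    exact congrArg _ (ih c hvc fun y hy => hσ y (.head hvc hy))

theorem IsForest.dependsOn_subtreeWeight_right (h : IsForest r lev) (v : W) (σ : W → A) :
    DependsOn (fun τ : ι → B => subtreeWeight r e M N v σ τ) {y | ReflTransGen r v (e y)} := by
  classical
  intro τ τ' hτ
  induction v using h.induction with
  | ih v ih =>
    beta_reduce
    rw [h.subtreeWeight_eq, h.subtreeWeight_eq, dependsOn_leafWeight (r := r) v (σ v) hτ]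
    congr 1
    refine Finset.prod_congr rfl fun c hc => ?_
    have hvc : r v c := (Finset.mem_filter.1 hc).2
    exact congrArg _ (ih c hvc fun y hy => hτ y (.head hvc hy))

theorem IsForest.dependsOn_likelihood (h : IsForest r lev) (v : W) :
    DependsOn (fun τ : ι → B => likelihood r e M N v τ) {y | ReflTransGen r v (e y)} := by
  intro τ τ' hτ
  funext i
  refine Finset.expect_congr rfl fun σ _ => ?_
  congr 1
  exact h.dependsOn_subtreeWeight_right v σ hτ

/-- The recursion for the likelihoods: given the state at `v`, the observation at `v` and the
observations below the different children of `v` are independent. -/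
theorem IsForest.likelihood_eq [Nonempty A] (h : IsForest r lev) (v : W) (τ : ι → B) (i : A)
    [DecidableRel r] :
    likelihood r e M N v τ i = leafWeight e N v i τ *
      ∏ c with r v c, (M *ᵥ likelihood r e M N c τ) i := by
  classical
  have hA : (Fintype.card A : ℝ) ≠ 0 := by simp
  set I : (W → A) → ℝ := fun σ => if σ v = i then (Fintype.card A : ℝ) else 0 with hI
  set F : W → (W → A) → ℝ := fun c σ =>
    (Fintype.card A * M i (σ c)) * subtreeWeight r e M N c σ τ with hF
  have hFdep : ∀ c, DependsOn (F c) {y | ReflTransGen r c y} := fun c σ σ' hσ => by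
    simp only [hF]
    rw [hσ c .refl]
    exact congrArg _ (h.dependsOn_subtreeWeight_left c τ hσ)
  have hIdep : DependsOn I {v} := fun σ σ' hσ => by
    simp only [hI]
    rw [hσ v rfl]
  have hEI : 𝔼 σ, I σ = 1 := by
    rw [hI, expect_apply_coord v fun a => if a = i then (Fintype.card A : ℝ) else 0,
      Fintype.expect_eq_sum_div_card]
    simp [hA]
  have hEF : ∀ c, 𝔼 σ, F c σ = (M *ᵥ likelihood r e M N c τ) i := by
    intro c
    simp only [Matrix.mulVec, dotProduct, likelihood, Finset.mul_expect, hF]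
    rw [← Finset.expect_sum_comm]
    refine Finset.expect_congr rfl fun σ _ => ?_
    rw [Finset.sum_eq_single (σ c)]
    · rw [if_pos rfl]; ring
    · intro j _ hj
      rw [if_neg hj.symm]; ring
    · simp
  calc likelihood r e M N v τ i
      = 𝔼 σ, leafWeight e N v i τ * (I σ * ∏ c with r v c, F c σ) := by
        refine Finset.expect_congr rfl fun σ _ => ?_
        by_cases hσ : σ v = i
        · rw [h.subtreeWeight_eq]
          simp only [hI, hF, hσ]
          ring
        · simp [hI, hσ]
    _ = leafWeight e N v i τ * ((𝔼 σ, I σ) * 𝔼 σ, ∏ c with r v c, F c σ) := by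
        rw [← Finset.mul_expect]
        congr 1
        refine expect_mul_of_dependsOn hIdep (dependsOn_finset_prod
          (t := {y | TransGen r v y}) (fun c _ => hFdep c) ?_) ?_
        · intro c hc y hy
          exact TransGen.head' (Finset.mem_filter.1 hc).2 hy
        · rw [Set.disjoint_singleton_left]
          exact fun hv => (h.lev_lt_of_transGen hv).false
    _ = _ := by
        rw [hEI, one_mul, expect_prod_of_dependsOn _ (fun c _ => hFdep c)]
        · simp_rw [hEF]
        · exact (h.pairwiseDisjoint v).subset fun c hc => by simpa using hc

theorem IsForest.likelihood_nonneg [Nonempty A] (h : IsForest r lev) (hM : ∀ i j, 0 ≤ M i j)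
    (hN : ∀ a b, 0 ≤ N a b) (v : W) (τ : ι → B) (i : A) : 0 ≤ likelihood r e M N v τ i := by
  classical
  induction v using h.induction generalizing i with
  | ih v ih =>
    rw [h.likelihood_eq]
    refine mul_nonneg (leafWeight_nonneg hN _ _ _) (Finset.prod_nonneg fun c hc => ?_)
    exact Finset.sum_nonneg fun j _ => mul_nonneg (hM i j) (ih c (Finset.mem_filter.1 hc).2 j)

theorem expect_mulVec_eq_one {Ω : Type*} [Fintype Ω] (hM1 : ∀ i, ∑ j, M i j = 1)
    {f : Ω → A → ℝ} (hf : ∀ j, 𝔼 ω, f ω j = 1) (i : A) : 𝔼 ω, (M *ᵥ f ω) i = 1 := by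
  simp only [Matrix.mulVec, dotProduct]
  rw [Finset.expect_sum_comm]
  simp_rw [← Finset.mul_expect, hf, mul_one]
  exact hM1 i

theorem IsForest.expect_likelihood [Nonempty A] [Nonempty B] [DecidableEq ι] (h : IsForest r lev)
    (he : Function.Injective e) (hM1 : ∀ i, ∑ j, M i j = 1) (hN1 : ∀ a, ∑ b, N a b = 1) (v : W)
    (i : A) : 𝔼 τ, likelihood r e M N v τ i = 1 := by
  classical
  induction v using h.induction generalizing i with
  | ih v ih =>
    have hdep : ∀ c, DependsOn (fun τ : ι → B => (M *ᵥ likelihood r e M N c τ) i)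
        {y | ReflTransGen r c (e y)} := fun c =>
      (h.dependsOn_likelihood c).comp_left fun z => (M *ᵥ z) i
    have hleaf : DependsOn (leafWeight e N v i) {y | e y = v} := fun τ τ' hτ => by
      refine Finset.prod_congr rfl fun y _ => ?_
      split_ifs with hy
      · rw [hτ y hy]
      · rfl
    simp_rw [h.likelihood_eq v]
    rw [expect_mul_of_dependsOn hleaf
        (dependsOn_finset_prod (t := {y | TransGen r v (e y)}) (fun c _ => hdep c) ?_) ?_,
      expect_leafWeight he hN1, one_mul, expect_prod_of_dependsOn _ fun c _ => hdep c]
    · exact Finset.prod_eq_one fun c hc =>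
        expect_mulVec_eq_one hM1 (ih c (Finset.mem_filter.1 hc).2) i
    · exact (h.pairwiseDisjoint_preimage e v).subset fun c hc => by simpa using hc
    · intro c hc y hy
      exact TransGen.head' (Finset.mem_filter.1 hc).2 hy
    · refine Set.disjoint_left.2 fun y (hy : e y = v) (hy' : TransGen r v (e y)) => ?_
      rw [hy] at hy'
      exact (h.lev_lt_of_transGen hy').false

/-- The main estimate.  Let `Y` be a weight that is at most one and dominates `θ` times the sum over
the children.  If single observations have chi-square at most `δ`, and the loss factor of merging at
most `K` children is absorbed by `θ`, then the chi-square at each vertex `v` is at most `δ * Y v`. -/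
theorem IsForest.expect_chiSq_likelihood_le [Nonempty A] [Nonempty B] [DecidableEq ι]
    (h : IsForest r lev) (he : Function.Injective e)
    (hM0 : ∀ i j, 0 ≤ M i j) (hM1 : ∀ i, ∑ j, M i j = 1)
    (hN0 : ∀ a b, 0 ≤ N a b) (hN1 : ∀ a, ∑ b, N a b = 1)
    {H : Type*} [NormedAddCommGroup H] [InnerProductSpace ℝ H]
    {π : A → ℝ} {ℓ : (A → ℝ) →ₗ[ℝ] H} (hℓ : IsContrast π ℓ) (hπ : π ᵥ* M = π)
    {s : ℝ} (hMℓ : ∀ v, ‖ℓ (M *ᵥ v)‖ ≤ s * ‖ℓ v‖)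
    {C : ℝ} (hC : 0 ≤ C) (hmul : HasProductConstant π ℓ C) {δ θ : ℝ} {K : ℕ} (hδ : 0 ≤ δ)
    (hθ : (1 + C * √δ) ^ K * s ^ 2 ≤ θ) {Y : W → ℝ} (hY0 : ∀ v, 0 ≤ Y v) (hY1 : ∀ v, Y v ≤ 1)
    (hYe : ∀ y, Y (e y) = 1) [DecidableRel r] (hYr : ∀ v, θ * ∑ c with r v c, Y c ≤ Y v)
    (hK : ∀ v, (Finset.univ.filter fun c => r v c).card ≤ K) (hleaf : ∀ y c, ¬ r (e y) c)
    (hNδ : ∀ _ : ι, ∑ b, chiSq π ℓ (fun a => N a b) ≤ δ) (v : W) :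
    𝔼 τ, chiSq π ℓ (likelihood r e M N v τ) ≤ δ * Y v := by
  induction v using h.induction with
  | ih v ih =>
    by_cases hv : v ∈ Set.range e
    · obtain ⟨y, rfl⟩ := hv
      have hZ : ∀ τ, likelihood r e M N (e y) τ =
          (Fintype.card B : ℝ) • fun a => N a (τ y) := fun τ => by
        funext i
        rw [h.likelihood_eq, Finset.filter_false_of_mem (fun c _ => hleaf y c), Finset.prod_empty,
          mul_one, leafWeight_eq he]
        rfl
      simp_rw [hZ, chiSq_smul _ (Nat.cast_nonneg (Fintype.card B))]
      rw [expect_apply_coord y fun b => Fintype.card B * chiSq π ℓ (fun a => N a b),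
        ← Finset.mul_expect, Fintype.card_mul_expect, hYe, mul_one]
      exact hNδ y
    · set ch := Finset.univ.filter fun c => r v c with hch
      have hZ : ∀ τ, likelihood r e M N v τ =
          ∏ c ∈ ch, M *ᵥ likelihood r e M N c τ := fun τ => by
        funext i
        rw [h.likelihood_eq, leafWeight_eq_one hv, one_mul, Finset.prod_apply]
      have hZ0 : ∀ c τ i, 0 ≤ likelihood r e M N c τ i := fun c τ i =>
        h.likelihood_nonneg hM0 hN0 c τ i
      have hκ : 1 ≤ 1 + C * √δ := le_add_of_nonneg_right (by positivity)
      have hκ0 : 0 ≤ 1 + C * √δ := zero_le_one.trans hκ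
      have hstep : ∀ c ∈ ch, 𝔼 τ, chiSq π ℓ (M *ᵥ likelihood r e M N c τ) ≤
          s ^ 2 * (δ * Y c) := by
        intro c hc
        calc 𝔼 τ, chiSq π ℓ (M *ᵥ likelihood r e M N c τ)
            ≤ 𝔼 τ, s ^ 2 * chiSq π ℓ (likelihood r e M N c τ) :=
              Finset.expect_le_expect fun τ _ => hℓ.chiSq_mulVec_le hπ hMℓ (hZ0 c τ)
          _ ≤ _ := by
              rw [← Finset.mul_expect]
              exact mul_le_mul_of_nonneg_left (ih c (Finset.mem_filter.1 hc).2) (sq_nonneg s)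
      have hsum : (1 + C * √δ) ^ ch.card *
          ∑ c ∈ ch, 𝔼 τ, chiSq π ℓ (M *ᵥ likelihood r e M N c τ) ≤ δ * Y v := by
        calc _ ≤ (1 + C * √δ) ^ K * ∑ c ∈ ch, s ^ 2 * (δ * Y c) := by
              refine mul_le_mul (pow_le_pow_right₀ hκ (hK v)) (Finset.sum_le_sum hstep) ?_
                (pow_nonneg hκ0 K)
              exact Finset.sum_nonneg fun c _ => Finset.expect_nonneg fun τ _ =>
                hℓ.chiSq_nonneg fun i =>
                  Finset.sum_nonneg fun j _ => mul_nonneg (hM0 i j) (hZ0 c τ j)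
          _ = ((1 + C * √δ) ^ K * s ^ 2) * (δ * ∑ c ∈ ch, Y c) := by
              rw [← Finset.mul_sum, ← Finset.mul_sum]; ring
          _ ≤ θ * (δ * ∑ c ∈ ch, Y c) := by
              gcongr
              exact mul_nonneg hδ (Finset.sum_nonneg fun c _ => hY0 c)
          _ = δ * (θ * ∑ c ∈ ch, Y c) := by ring
          _ ≤ δ * Y v := mul_le_mul_of_nonneg_left (hYr v) hδ
      simp_rw [hZ]
      refine (hℓ.expect_chiSq_prod_le hC hmul (D := fun c => {y | ReflTransGen r c (e y)}) ch
        ?_ ?_ ?_ ?_ (hsum.trans (mul_le_of_le_one_right hδ (hY1 v)))).trans hsum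
      · exact fun c _ τ i => Finset.sum_nonneg fun j _ => mul_nonneg (hM0 i j) (hZ0 c τ j)
      · exact fun c _ i => expect_mulVec_eq_one hM1 (h.expect_likelihood he hM1 hN1 c) i
      · exact fun c _ => (h.dependsOn_likelihood c).comp_left fun z => M *ᵥ z
      · exact (h.pairwiseDisjoint_preimage e v).subset fun c hc => by simpa [hch] using hc

end Likelihood

/-! ### The stationary law and a contrast adapted to the second eigenvalue -/

section Spectral

variable {A : Type*} [Fintype A] [DecidableEq A]

/-- An irreducible stochastic matrix has a strictly positive stationary distribution: the absolute
value of a left eigenvector for the eigenvalue one is again a left eigenvector. -/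
theorem exists_stationary [Nonempty A] {M : Matrix A A ℝ} (hM : M ∈ Matrix.rowStochastic ℝ A)
    (hirr : M.IsIrreducible) : ∃ π : A → ℝ, (∀ i, 0 < π i) ∧ ∑ i, π i = 1 ∧ π ᵥ* M = π := by
  have hM0 : ∀ i j, 0 ≤ M i j := fun i j => Matrix.nonneg_of_mem_rowStochastic hM
  have hM1 : ∀ i, ∑ j, M i j = 1 := Matrix.sum_row_of_mem_rowStochastic hM
  have hdet : (M - 1).det = 0 := by
    refine Matrix.exists_mulVec_eq_zero_iff.1 ⟨1, one_ne_zero, ?_⟩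
    rw [Matrix.sub_mulVec, Matrix.one_vecMul_of_mem_rowStochastic hM, Matrix.one_mulVec, sub_self]
  obtain ⟨w, hw0, hw⟩ := Matrix.exists_vecMul_eq_zero_iff.2 hdet
  rw [Matrix.vecMul_sub, Matrix.vecMul_one, sub_eq_zero] at hw
  set u : A → ℝ := fun i => |w i| with hu
  have hle : ∀ j, u j ≤ (u ᵥ* M) j := by
    intro j
    calc u j = |(w ᵥ* M) j| := by rw [hw]
      _ ≤ ∑ i, |w i * M i j| := Finset.abs_sum_le_sum_abs _ _
      _ = (u ᵥ* M) j := Finset.sum_congr rfl fun i _ => by rw [abs_mul, abs_of_nonneg (hM0 i j)]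
  have hsum : ∑ j, (u ᵥ* M) j = ∑ j, u j := by
    simp only [Matrix.vecMul, dotProduct]
    rw [Finset.sum_comm]
    simp_rw [← Finset.mul_sum, hM1, mul_one]
  have huM : u ᵥ* M = u := by
    funext j
    exact ((Finset.sum_eq_sum_iff_of_le fun j _ => hle j).1 hsum.symm j (Finset.mem_univ j)).symm
  have hpow : ∀ n : ℕ, u ᵥ* M ^ n = u := by
    intro n
    induction n with
    | zero => simp
    | succ n ih => rw [pow_succ, ← Matrix.vecMul_vecMul, ih, huM]
  obtain ⟨i, hi⟩ : ∃ i, w i ≠ 0 := Function.ne_iff.1 hw0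
  have hpos : ∀ j, 0 < u j := by
    intro j
    obtain ⟨n, -, hn⟩ := (Matrix.isIrreducible_iff_exists_pow_pos hM0).1 hirr i j
    rw [← hpow n]
    refine Finset.sum_pos' (fun k _ => mul_nonneg (abs_nonneg _) ?_)
      ⟨i, Finset.mem_univ i, mul_pos (abs_pos.2 hi) hn⟩
    exact Matrix.nonneg_of_mem_rowStochastic (pow_mem hM n)
  have hS : 0 < ∑ j, u j := Finset.sum_pos (fun j _ => hpos j) Finset.univ_nonempty
  refine ⟨(∑ j, u j)⁻¹ • u, fun j => mul_pos (inv_pos.2 hS) (hpos j), ?_, ?_⟩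
  · simp only [Pi.smul_apply, smul_eq_mul]
    rw [← Finset.mul_sum, inv_mul_cancel₀ hS.ne']
  · rw [Matrix.smul_vecMul, huM]

open Polynomial in
/-- Deflation: subtracting the projection onto the constants along `π` replaces one eigenvalue `1`
of a matrix with unit row sums by the eigenvalue `0`. -/
theorem charpoly_sub_vecMulVec [Nonempty A] {K : Type*} [Field K] (M : Matrix A A K) (π : A → K)
    (hM : M *ᵥ 1 = 1) (hπ : ∑ i, π i = 1) :
    (X - 1) * (M - Matrix.vecMulVec 1 π).charpoly = X * M.charpoly := by
  set E : Matrix A A K[X] := Matrix.vecMulVec 1 fun j => C (π j) with hE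
  have hR : (M - Matrix.vecMulVec 1 π).charmatrix = M.charmatrix + E := by
    ext1 i j
    simp [Matrix.charmatrix_apply, hE]
    ring
  have hME : M.charmatrix * E = (X - 1 : K[X]) • E := by
    have h1 : M.charmatrix *ᵥ 1 = (X - 1 : K[X]) • 1 := by
      funext i
      have : ∑ j, M i j = 1 := by simpa [Matrix.mulVec, dotProduct] using congrFun hM i
      simp only [Matrix.mulVec, dotProduct, Matrix.charmatrix_apply, Pi.one_apply, mul_one,
        Finset.sum_sub_distrib, Pi.smul_apply, smul_eq_mul]
      rw [← map_sum, this, map_one]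
      simp [Matrix.diagonal_apply]
    rw [hE, Matrix.mul_vecMulVec, h1, Matrix.smul_vecMulVec]
  have hfac : (X - 1 : K[X]) • (M - Matrix.vecMulVec 1 π).charmatrix =
      M.charmatrix * (Matrix.scalar A (X - 1 : K[X]) - -E) := by
    rw [hR, sub_neg_eq_add, mul_add, hME, smul_add]
    congr 1
    rw [Matrix.scalar_apply, ← Matrix.smul_one_eq_diagonal, Matrix.mul_smul, mul_one]
  have hE' : -E = Matrix.vecMulVec (-1) fun j => C (π j) := by
    rw [hE, Matrix.neg_vecMulVec]
  have hdet := congrArg Matrix.det hfac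
  obtain ⟨n, hn⟩ : ∃ n, Fintype.card A = n + 1 := Nat.exists_eq_succ_of_ne_zero Fintype.card_ne_zero
  rw [Matrix.det_smul, Matrix.det_mul, ← Matrix.eval_charpoly, hE', Matrix.charpoly_vecMulVec,
    hn] at hdet
  have hdot : (-1 : A → K[X]) ⬝ᵥ (fun j => C (π j)) = -1 := by
    rw [neg_dotProduct]
    simp [dotProduct, ← map_sum, hπ]
  rw [hdot] at hdet
  have hX : (X - 1 : K[X]) ≠ 0 := by simpa using X_sub_C_ne_zero (1 : K)
  refine mul_left_cancel₀ (pow_ne_zero n hX) ?_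
  have h1 : (M - Matrix.vecMulVec 1 π).charmatrix.det = (M - Matrix.vecMulVec 1 π).charpoly := rfl
  have h2 : M.charmatrix.det = M.charpoly := rfl
  rw [h1, h2] at hdet
  simp only [neg_smul, one_smul, eval_sub, eval_pow, eval_X, eval_neg,
    Nat.add_sub_cancel] at hdet
  rw [← mul_assoc, ← pow_succ, hdet]
  ring

/-- If `t ≤ 1`, and `1` and `t` (counted with multiplicity) occur in `s`, the second largest
element of `s` is at least `t`. -/
theorem le_getD_one_of_pair_le {s : Multiset ℝ} {t : ℝ} (ht : t ≤ 1) (h : {1, t} ≤ s) :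
    t ≤ (s.sort (· ≥ ·)).getD 1 0 := by
  have hs : (↑(s.sort (· ≥ ·)) : Multiset ℝ) = s := Multiset.sort_eq s _
  have hpw : (s.sort (· ≥ ·)).Pairwise (· ≥ ·) := Multiset.pairwise_sort s _
  rw [← hs] at h
  generalize s.sort (· ≥ ·) = l at h hpw
  match l, h, hpw with
  | [], h, _ => exact absurd (Multiset.card_le_card h) (by simp)
  | [a], h, _ => exact absurd (Multiset.card_le_card h) (by simp)
  | a :: b :: l, h, hpw =>
    show t ≤ b
    by_contra! hb
    have hpw' := (List.pairwise_cons.1 hpw).2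
    have hall : ∀ x ∈ b :: l, x < t := by
      intro x hx
      rcases List.mem_cons.1 hx with rfl | hx
      · exact hb
      · exact ((List.pairwise_cons.1 hpw').1 x hx).trans_lt hb
    have h2 : (Multiset.filter (t ≤ ·) {1, t}).card ≤
        (Multiset.filter (t ≤ ·) (↑(a :: b :: l) : Multiset ℝ)).card :=
      Multiset.card_le_card (Multiset.filter_le_filter _ h)
    have h3 : Multiset.filter (t ≤ ·) (↑(b :: l) : Multiset ℝ) = 0 :=
      Multiset.filter_eq_nil.2 fun x hx => (hall x hx).not_ge
    rw [← Multiset.cons_coe a (b :: l), Multiset.filter_cons, h3] at h2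
    have h4 : Multiset.filter (t ≤ ·) {1, t} = {1, t} :=
      Multiset.filter_eq_self.2 fun x hx => by
        rcases Multiset.mem_cons.1 hx with rfl | hx
        · exact ht
        · exact (Multiset.mem_singleton.1 hx).ge
    rw [h4] at h2
    split_ifs at h2 <;> simp at h2

theorem absSecondEigenvalue_nonneg (M : Matrix A A ℝ) : 0 ≤ absSecondEigenvalue M := by
  rw [absSecondEigenvalue, List.getD_eq_getElem?_getD]
  cases h : (((M.map (algebraMap ℝ ℂ)).charpoly.roots.map
    (fun z : ℂ => ‖z‖)).sort (· ≥ ·))[1]? with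
  | none => exact le_rfl
  | some x =>
    have := List.mem_of_getElem? h
    rw [Multiset.mem_sort, Multiset.mem_map] at this
    obtain ⟨z, -, rfl⟩ := this
    exact norm_nonneg z

/-- The eigenvalues left after deflation are bounded by `|λ₂(M)|`. -/
theorem norm_le_absSecondEigenvalue [Nonempty A] {M : Matrix A A ℝ}
    (hM : M ∈ Matrix.rowStochastic ℝ A) {π : A → ℝ} (hπ : ∑ i, π i = 1) {z : ℂ}
    (hz : ((M - Matrix.vecMulVec 1 π).map (algebraMap ℝ ℂ)).charpoly.IsRoot z) :
    ‖z‖ ≤ absSecondEigenvalue M := by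
  rcases eq_or_ne z 0 with rfl | hz0
  · simpa using absSecondEigenvalue_nonneg M
  set Mc := M.map (algebraMap ℝ ℂ) with hMc
  have hM1 : ∀ i, ∑ j, M i j = 1 := Matrix.sum_row_of_mem_rowStochastic hM
  have hMc1 : Mc *ᵥ 1 = 1 := by
    funext i
    simp only [Matrix.mulVec, dotProduct, Pi.one_apply, mul_one, hMc, Matrix.map_apply]
    rw [← map_sum, hM1, map_one]
  have hdefl := charpoly_sub_vecMulVec Mc (fun j => (π j : ℂ)) hMc1 (by exact_mod_cast hπ)
  have hRc : (M - Matrix.vecMulVec 1 π).map (algebraMap ℝ ℂ) =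
      Mc - Matrix.vecMulVec 1 fun j => (π j : ℂ) := by
    ext i j
    simp [hMc]
  rw [hRc] at hz
  set Rc := Mc - Matrix.vecMulVec 1 fun j => (π j : ℂ)
  have hR0 : Rc.charpoly ≠ 0 := (Matrix.charpoly_monic _).ne_zero
  have hMc0 : Mc.charpoly ≠ 0 := (Matrix.charpoly_monic _).ne_zero
  have hX1 : (Polynomial.X - 1 : Polynomial ℂ) ≠ 0 := by
    simpa using Polynomial.X_sub_C_ne_zero (1 : ℂ)
  have hroots : (1 : ℂ) ::ₘ Rc.charpoly.roots = 0 ::ₘ Mc.charpoly.roots := by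
    have := congrArg Polynomial.roots hdefl
    rw [Polynomial.roots_mul (mul_ne_zero hX1 hR0),
      Polynomial.roots_mul (mul_ne_zero Polynomial.X_ne_zero hMc0), Polynomial.roots_X] at this
    have h1 : (Polynomial.X - 1 : Polynomial ℂ).roots = {1} := by
      simpa using Polynomial.roots_X_sub_C (1 : ℂ)
    rwa [h1, Multiset.singleton_add, Multiset.singleton_add] at this
  have hzR : z ∈ Rc.charpoly.roots := (Polynomial.mem_roots hR0).2 hz
  have hpair : ({1, z} : Multiset ℂ) ≤ Mc.charpoly.roots := by
    have h1 : ({1, z} : Multiset ℂ) ≤ 0 ::ₘ Mc.charpoly.roots := by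
      rw [← hroots]
      exact Multiset.cons_le_cons _ (Multiset.singleton_le.2 hzR)
    refine (Multiset.le_cons_of_notMem ?_).1 h1
    simp [hz0.symm]
  have hzM : Mc.charpoly.IsRoot z :=
    Polynomial.isRoot_of_mem_roots (Multiset.mem_of_le hpair (by simp))
  have hz1 : ‖z‖ ≤ 1 := by
    obtain ⟨v, hv0, hv⟩ := Matrix.exists_mulVec_eq_zero_iff.2
      (show (Matrix.scalar A z - Mc).det = 0 by rw [← Matrix.eval_charpoly]; exact hzM)
    rw [Matrix.sub_mulVec, sub_eq_zero] at hv
    have hv' : ∀ i, z * v i = ∑ j, (M i j : ℂ) * v j := fun i => by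
      have := congrFun hv i
      rw [Matrix.scalar_apply, Matrix.mulVec_diagonal] at this
      exact this
    obtain ⟨i, -, hi⟩ := Finset.exists_max_image Finset.univ (fun i => ‖v i‖) Finset.univ_nonempty
    have hvi : 0 < ‖v i‖ := by
      obtain ⟨j, hj⟩ := Function.ne_iff.1 hv0
      exact (norm_pos_iff.2 hj).trans_le (hi j (Finset.mem_univ j))
    refine le_of_mul_le_mul_right ?_ hvi
    calc ‖z‖ * ‖v i‖ = ‖∑ j, (M i j : ℂ) * v j‖ := by rw [← norm_mul, hv']
      _ ≤ ∑ j, M i j * ‖v i‖ := by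
        refine (norm_sum_le _ _).trans (Finset.sum_le_sum fun j _ => ?_)
        have h0 : 0 ≤ M i j := Matrix.nonneg_of_mem_rowStochastic hM
        rw [norm_mul, Complex.norm_real, Real.norm_of_nonneg h0]
        exact mul_le_mul_of_nonneg_left (hi j (Finset.mem_univ j)) h0
      _ = 1 * ‖v i‖ := by rw [← Finset.sum_mul, hM1]
  refine le_getD_one_of_pair_le hz1 ?_
  have hnorms := Multiset.map_le_map (f := fun z : ℂ => ‖z‖) hpair
  rw [Multiset.insert_eq_cons, Multiset.map_cons, Multiset.map_singleton, norm_one] at hnorms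
  exact hnorms

attribute [local instance] Matrix.linftyOpNormedAddCommGroup Matrix.linftyOpNormedRing
  Matrix.linftyOpNormedAlgebra

open Filter Topology in
/-- If all eigenvalues of `R` are smaller than `s` in absolute value, some power `R ^ m` has
Euclidean operator norm at most `s ^ m`. -/
theorem exists_pow_sum_sq_le [Nonempty A] (R : Matrix A A ℝ) {s : ℝ} (hs : 0 < s)
    (hR : ∀ z : ℂ, (R.map (algebraMap ℝ ℂ)).charpoly.IsRoot z → ‖z‖ < s) :
    ∃ m : ℕ, 0 < m ∧ ∀ w : A → ℝ,
      ∑ i, ((R ^ m) *ᵥ w) i ^ 2 ≤ (s ^ m) ^ 2 * ∑ i, w i ^ 2 := by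
  set Rc := R.map (algebraMap ℝ ℂ) with hRc
  lift s to NNReal using hs.le
  -- Gelfand's formula, for the operator norm of the supremum norm; the constant relating it to the
  -- Euclidean norm is absorbed by a large power of `q / s`
  have hrad : spectralRadius ℂ Rc < s :=
    spectrum.spectralRadius_lt_of_forall_lt Rc fun z hz =>
      NNReal.coe_lt_coe.1 (hR z (Matrix.mem_spectrum_iff_isRoot_charpoly.1 hz))
  obtain ⟨q, hq1, hq2⟩ := ENNReal.lt_iff_exists_nnreal_btwn.1 hrad
  have hqs : q < s := by exact_mod_cast hq2
  have hgel := spectrum.pow_nnnorm_pow_one_div_tendsto_nhds_spectralRadius Rc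
  have hev1 : ∀ᶠ m : ℕ in atTop, ‖Rc ^ m‖ ≤ (q : ℝ) ^ m := by
    filter_upwards [hgel.eventually (gt_mem_nhds hq1), eventually_gt_atTop 0] with m hm hm0
    have h1 : ((‖Rc ^ m‖₊ : ENNReal) ^ (1 / m : ℝ)) ^ (m : ℝ) ≤ (q : ENNReal) ^ (m : ℝ) :=
      ENNReal.rpow_le_rpow hm.le (Nat.cast_nonneg m)
    rw [← ENNReal.rpow_mul, one_div_mul_cancel (by positivity), ENNReal.rpow_one,
      ENNReal.rpow_natCast] at h1
    exact_mod_cast h1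
  have hev2 : ∀ᶠ m : ℕ in atTop, (Fintype.card A : ℝ) * ((q / s : ℝ) ^ 2) ^ m < 1 := by
    have hlt : ((q / s : ℝ)) ^ 2 < 1 :=
      pow_lt_one₀ (by positivity) ((div_lt_one hs).2 (by exact_mod_cast hqs)) two_ne_zero
    have := (tendsto_pow_atTop_nhds_zero_of_lt_one (sq_nonneg _) hlt).const_mul
      (Fintype.card A : ℝ)
    rw [mul_zero] at this
    exact this.eventually (gt_mem_nhds one_pos)
  obtain ⟨m, h1, h2, hm⟩ := (hev1.and (hev2.and (eventually_gt_atTop 0))).exists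
  refine ⟨m, hm, fun w => ?_⟩
  set S := ∑ i, w i ^ 2 with hS
  have hS0 : 0 ≤ S := Finset.sum_nonneg fun i _ => sq_nonneg _
  have hwS : ‖(fun i => (w i : ℂ))‖ ≤ √S := by
    refine (pi_norm_le_iff_of_nonneg (Real.sqrt_nonneg _)).2 fun i => ?_
    rw [Complex.norm_real, Real.norm_eq_abs, ← Real.sqrt_sq_eq_abs]
    exact Real.sqrt_le_sqrt
      (Finset.single_le_sum (f := fun i => w i ^ 2) (fun i _ => sq_nonneg _) (Finset.mem_univ i))
  have hcoord : ∀ i, ((R ^ m) *ᵥ w) i ^ 2 ≤ (q : ℝ) ^ (2 * m) * S := by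
    intro i
    have e : ((((R ^ m) *ᵥ w) i : ℝ) : ℂ) = ((Rc ^ m) *ᵥ fun i => (w i : ℂ)) i := by
      have hp : Rc ^ m = (R ^ m).map (algebraMap ℝ ℂ) := by
        rw [hRc, ← RingHom.mapMatrix_apply, ← map_pow, RingHom.mapMatrix_apply]
      rw [hp]
      simp [Matrix.mulVec, dotProduct]
    have h3 : |((R ^ m) *ᵥ w) i| ≤ (q : ℝ) ^ m * √S := by
      rw [← Real.norm_eq_abs, ← Complex.norm_real, e]
      calc _ ≤ ‖(Rc ^ m) *ᵥ fun i => (w i : ℂ)‖ := norm_le_pi_norm _ i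
        _ ≤ ‖Rc ^ m‖ * ‖fun i => (w i : ℂ)‖ := Matrix.linfty_opNorm_mulVec _ _
        _ ≤ _ := mul_le_mul h1 hwS (norm_nonneg _) (by positivity)
    calc ((R ^ m) *ᵥ w) i ^ 2 = |((R ^ m) *ᵥ w) i| ^ 2 := (sq_abs _).symm
      _ ≤ ((q : ℝ) ^ m * √S) ^ 2 := by gcongr
      _ = _ := by rw [mul_pow, Real.sq_sqrt hS0]; ring
  calc ∑ i, ((R ^ m) *ᵥ w) i ^ 2 ≤ ∑ _i : A, (q : ℝ) ^ (2 * m) * S :=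
        Finset.sum_le_sum fun i _ => hcoord i
    _ = (Fintype.card A * ((q / s : ℝ) ^ 2) ^ m) * (((s : ℝ) ^ m) ^ 2 * S) := by
        rw [Finset.sum_const, Finset.card_univ, nsmul_eq_mul]
        have hs0 : (s : ℝ) ≠ 0 := hs.ne'
        have e : ((q / s : ℝ) ^ 2) ^ m * ((s : ℝ) ^ m) ^ 2 = (q : ℝ) ^ (2 * m) := by
          rw [← pow_mul, ← pow_mul, mul_comm m 2, ← mul_pow, div_mul_cancel₀ _ hs0]
        rw [← e]
        ring
    _ ≤ 1 * (((s : ℝ) ^ m) ^ 2 * S) := by gcongr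
    _ = _ := one_mul _

/-- For every `s > |λ₂(M)|` there is a contrast that `M` contracts by the factor `s`.  With
`R = M - 1 πᵀ` and `w = v - π ⬝ v` it is `(s ^ (-n) R ^ n w)_{n < m}`, where `R ^ m` contracts by
`s ^ m` in the Euclidean norm: passing from `v` to `M v` shifts the index `n` by one. -/
theorem exists_contrast [Nonempty A] {M : Matrix A A ℝ} (hM : M ∈ Matrix.rowStochastic ℝ A)
    (hirr : M.IsIrreducible) {s : ℝ} (hs : absSecondEigenvalue M < s) :
    ∃ (π : A → ℝ) (m : ℕ) (ℓ : (A → ℝ) →ₗ[ℝ] EuclideanSpace ℝ (Fin m × A)),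
      IsContrast π ℓ ∧ π ᵥ* M = π ∧ ∀ v, ‖ℓ (M *ᵥ v)‖ ≤ s * ‖ℓ v‖ := by
  obtain ⟨π, hπ0, hπ1, hπM⟩ := exists_stationary hM hirr
  have hs0 : 0 < s := (absSecondEigenvalue_nonneg M).trans_lt hs
  set R := M - Matrix.vecMulVec 1 π with hR
  obtain ⟨m, hm, hRm⟩ := exists_pow_sum_sq_le R hs0 fun z hz =>
    (norm_le_absSecondEigenvalue hM hπ1 hz).trans_lt hs
  set p : Matrix A A ℝ := 1 - Matrix.vecMulVec 1 π with hp
  have hp_apply : ∀ v i, (p *ᵥ v) i = v i - π ⬝ᵥ v := by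
    intro v i
    rw [hp, Matrix.sub_mulVec, Matrix.one_mulVec, Matrix.vecMulVec_mulVec]
    simp
  have hM1 : M *ᵥ 1 = 1 := Matrix.one_vecMul_of_mem_rowStochastic hM
  have hpM : p * M = R := by
    rw [hp, sub_mul, one_mul, Matrix.vecMulVec_mul, hπM]
  have hπ1' : π ⬝ᵥ (1 : A → ℝ) = 1 := by simpa [dotProduct] using hπ1
  have hRp : R * p = R := by
    have h1 : R *ᵥ 1 = 0 := by
      rw [hR, Matrix.sub_mulVec, hM1, Matrix.vecMulVec_mulVec, hπ1']
      simp
    rw [hp, mul_sub, mul_one, Matrix.mul_vecMulVec, h1]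
    simp
  set ℓ : (A → ℝ) →ₗ[ℝ] EuclideanSpace ℝ (Fin m × A) :=
    (WithLp.linearEquiv 2 ℝ (Fin m × A → ℝ)).symm.toLinearMap ∘ₗ
      LinearMap.pi fun k : Fin m × A =>
        (s⁻¹ ^ (k.1 : ℕ)) • (LinearMap.proj k.2 ∘ₗ (R ^ (k.1 : ℕ) * p).mulVecLin) with hℓ
  have hnorm : ∀ v, ‖ℓ v‖ ^ 2 =
      ∑ n ∈ Finset.range m, (s⁻¹ ^ n) ^ 2 * ∑ i, ((R ^ n * p) *ᵥ v) i ^ 2 := by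
    intro v
    rw [EuclideanSpace.norm_sq_eq, Fintype.sum_prod_type, ← Fin.sum_univ_eq_sum_range
      (fun n => (s⁻¹ ^ n) ^ 2 * ∑ i, ((R ^ n * p) *ᵥ v) i ^ 2)]
    refine Finset.sum_congr rfl fun n _ => ?_
    rw [Finset.mul_sum]
    refine Finset.sum_congr rfl fun i _ => ?_
    rw [Real.norm_eq_abs, sq_abs, ← mul_pow]
    rfl
  refine ⟨π, m, ℓ, ⟨hπ0, hπ1, ?_, ?_⟩, hπM, ?_⟩
  · have h1 : p *ᵥ 1 = 0 := by
      funext i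
      rw [hp_apply, hπ1']
      simp
    rw [← norm_eq_zero, ← sq_eq_zero_iff, hnorm]
    simp [← Matrix.mulVec_mulVec, h1]
  · intro v i
    rw [← hp_apply]
    refine abs_le_of_sq_le_sq ?_ (norm_nonneg _)
    rw [hnorm]
    have h1 := Finset.single_le_sum
      (f := fun n => (s⁻¹ ^ n) ^ 2 * ∑ i, ((R ^ n * p) *ᵥ v) i ^ 2)
      (fun n _ => mul_nonneg (sq_nonneg _) (Finset.sum_nonneg fun i _ => sq_nonneg _))
      (Finset.mem_range.2 hm)
    refine le_trans ?_ h1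
    simp only [pow_zero, one_pow, one_mul]
    exact Finset.single_le_sum (f := fun i => (p *ᵥ v) i ^ 2) (fun i _ => sq_nonneg _)
      (Finset.mem_univ i)
  · intro v
    refine (pow_le_pow_iff_left₀ (norm_nonneg _) (by positivity) two_ne_zero).1 ?_
    set f : ℕ → ℝ := fun n => (s⁻¹ ^ n) ^ 2 * ∑ i, ((R ^ n * p) *ᵥ v) i ^ 2 with hf
    have hshift : ∀ n, (s⁻¹ ^ n) ^ 2 * ∑ i, ((R ^ n * p) *ᵥ (M *ᵥ v)) i ^ 2 =
        s ^ 2 * f (n + 1) := by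
      intro n
      have e : (R ^ n * p) *ᵥ (M *ᵥ v) = (R ^ (n + 1) * p) *ᵥ v := by
        rw [Matrix.mulVec_mulVec, mul_assoc, hpM, pow_succ, mul_assoc, hRp]
      rw [e, hf]
      simp only [pow_succ]
      field_simp
    have hfm : f m ≤ f 0 := by
      simp only [hf, pow_zero, one_pow, one_mul, ← Matrix.mulVec_mulVec]
      calc _ ≤ (s⁻¹ ^ m) ^ 2 * ((s ^ m) ^ 2 * ∑ i, (p *ᵥ v) i ^ 2) := by
            gcongr
            exact hRm _
        _ = _ := by
            rw [← mul_assoc, ← mul_pow, ← mul_pow, inv_mul_cancel₀ hs0.ne', one_pow, one_pow,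
              one_mul, Matrix.one_mulVec]
    rw [hnorm, mul_pow, hnorm]
    simp_rw [hshift]
    rw [← Finset.mul_sum]
    refine mul_le_mul_of_nonneg_left ?_ (sq_nonneg s)
    have h1 := Finset.sum_range_succ f m
    have h2 := Finset.sum_range_succ' f m
    linarith

end Spectral

/-! ### The likelihood at the root -/

section RootLikelihood

open Relation
open scoped Classical

variable {W A B ι : Type*} [Fintype W] [Fintype A] [Fintype B] [Fintype ι]
  {r : W → W → Prop} {lev : W → ℕ} {e : ι → W} {M : Matrix A A ℝ} {N : Matrix A B ℝ}

/-- In a tree with root `o` the normalising factors cancel, and the likelihood at the root is, up to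
the factor `|B| ^ |ι|`, the sum over all configurations of the product of the transition and
observation probabilities. -/
theorem IsForest.likelihood_root [Nonempty A] (h : IsForest r lev) {o : W}
    (ho : ∀ y, ReflTransGen r o y) (τ : ι → B) (i : A) :
    likelihood r e M N o τ i = (Fintype.card B : ℝ) ^ Fintype.card ι *
      ∑ σ : W → A, (if σ o = i then 1 else 0) *
        (∏ p : W × W, if r p.1 p.2 then M (σ p.1) (σ p.2) else 1) * ∏ y, N (σ (e y)) (τ y) := by
  have hA : (Fintype.card A : ℝ) ≠ 0 := by simp
  have hno : ∀ x, ¬ r x o := fun x hx =>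
    (h.lev_lt_of_transGen (TransGen.tail' (ho x) hx)).false
  have hset : (Finset.univ.filter fun y => TransGen r o y) = Finset.univ.erase o := by
    ext y
    rw [Finset.mem_filter, Finset.mem_erase]
    refine ⟨fun hy => ⟨?_, Finset.mem_univ y⟩, fun hy => ⟨Finset.mem_univ y, ?_⟩⟩
    · rintro rfl
      exact (h.lev_lt_of_transGen hy.2).false
    · exact (reflTransGen_iff_eq_or_transGen.1 (ho y)).resolve_left hy.1
  have hedge : ∀ (σ : W → A), ∀ y ∈ Finset.univ.erase o, edgeWeight r M y σ =
      Fintype.card A * ∏ x, if r x y then M (σ x) (σ y) else 1 := by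
    intro σ y hy
    rw [← hset] at hy
    obtain ⟨x, -, hxy⟩ := TransGen.tail'_iff.1 (Finset.mem_filter.1 hy).2
    rw [h.edgeWeight_eq hxy, Finset.prod_eq_single x, if_pos hxy]
    · intro z _ hz
      rw [if_neg fun hzy => hz (h.unique hzy hxy)]
    · simp
  have hleaf : ∀ σ : W → A, ∏ y, leafWeight e N y (σ y) τ =
      (Fintype.card B : ℝ) ^ Fintype.card ι * ∏ y, N (σ (e y)) (τ y) := by
    intro σ
    simp only [leafWeight]
    rw [Finset.prod_comm]
    simp [Finset.prod_mul_distrib]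
  have hprod : ∀ σ : W → A, subtreeWeight r e M N o σ τ =
      (Fintype.card B : ℝ) ^ Fintype.card ι * (Fintype.card A : ℝ) ^ (Fintype.card W - 1) *
        ((∏ p : W × W, if r p.1 p.2 then M (σ p.1) (σ p.2) else 1) *
          ∏ y, N (σ (e y)) (τ y)) := by
    intro σ
    have h1 : ∏ p : W × W, (if r p.1 p.2 then M (σ p.1) (σ p.2) else 1) =
        ∏ y ∈ Finset.univ.erase o, ∏ x, if r x y then M (σ x) (σ y) else 1 := by
      rw [Fintype.prod_prod_type_right, ← Finset.mul_prod_erase _ _ (Finset.mem_univ o),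
        Finset.prod_eq_one (fun x _ => if_neg (hno x)), one_mul]
    rw [subtreeWeight, hset, Finset.prod_mul_distrib, Finset.prod_congr rfl (hedge σ),
      Finset.prod_mul_distrib, Finset.prod_const, Finset.card_erase_of_mem (Finset.mem_univ o),
      Finset.card_univ, mul_left_comm, Finset.mul_prod_erase _ (fun y => leafWeight e N y (σ y) τ)
        (Finset.mem_univ o), hleaf, h1]
    ring
  have hW : Fintype.card W - 1 + 1 = Fintype.card W :=
    Nat.sub_add_cancel (Fintype.card_pos_iff.2 ⟨o⟩)
  have hcard : (Fintype.card (W → A) : ℝ) =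
      Fintype.card A * (Fintype.card A : ℝ) ^ (Fintype.card W - 1) := by
    rw [Fintype.card_fun, Nat.cast_pow, ← pow_succ', hW]
  rw [likelihood, Fintype.expect_eq_sum_div_card, div_eq_iff (by simp), hcard, Finset.mul_sum,
    Finset.sum_mul]
  refine Finset.sum_congr rfl fun σ _ => ?_
  rw [hprod]
  split_ifs <;> ring

end RootLikelihood

/-! ### Rays and cutsets in a rooted tree -/

section Tree

open Relation

variable {V : Type*} {G : SimpleGraph V} {ρ : V}

theorem isForest_isChild (hG : G.IsTree) (ρ : V) : IsForest (IsChild G ρ) (G.dist ρ) where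
  lev_succ h := h.2
  unique := by
    intro x y z hx hy
    classical
    have key : ∀ x, IsChild G ρ x z → ∃ p : G.Path ρ z, p.1.penultimate = x := by
      intro x hx
      obtain ⟨p, hp⟩ := hG.connected.exists_walk_length_eq_dist ρ x
      refine ⟨⟨p.concat hx.1, SimpleGraph.Walk.isPath_of_length_eq_dist _ ?_⟩, by simp⟩
      rw [SimpleGraph.Walk.length_concat, hp, hx.2]
    obtain ⟨p, hp⟩ := key x hx
    obtain ⟨q, hq⟩ := key y hy
    rw [← hp, ← hq, (hG.isAcyclic.subsingleton_path ρ z).elim p q]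

theorem isChild_or_isChild (hG : G.IsTree) {x y : V} (h : G.Adj x y) :
    IsChild G ρ x y ∨ IsChild G ρ y x :=
  (hG.dist_eq_dist_add_one_of_adj ρ h).symm.imp (fun e => ⟨h, e⟩) fun e => ⟨h.symm, e⟩

theorem reflTransGen_root (hG : G.IsTree) (x : V) : ReflTransGen (IsChild G ρ) ρ x := by
  induction hn : G.dist ρ x generalizing x with
  | zero => rw [(hG.connected.dist_eq_zero_iff).1 hn]
  | succ n ih =>
    obtain ⟨p, hp⟩ := hG.connected.exists_walk_length_eq_dist x ρ
    rw [SimpleGraph.dist_comm, hn] at hp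
    cases p with
    | nil => simp at hp
    | @cons _ y _ h p =>
      have h1 : G.dist ρ y ≤ n := by
        rw [SimpleGraph.dist_comm]
        have := G.dist_le p
        rw [SimpleGraph.Walk.length_cons] at hp
        omega
      have hc : IsChild G ρ y x := by
        refine (isChild_or_isChild hG h.symm).resolve_right fun h2 => ?_
        have := h2.2
        omega
      exact (ih y (by have := hc.2; omega)).tail hc

/-- A vertex is inside `S` exactly when `S` contains none of its ancestors (itself included). -/
theorem mem_ins_iff (hG : G.IsTree) {S : Finset V} {x : V} :
    x ∈ Ins G ρ S ↔ ∀ z, ReflTransGen (IsChild G ρ) z x → z ∉ S := by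
  constructor
  · rintro ⟨p, hp⟩
    have key : ∀ {u v : V} (p : G.Walk u v), (∀ z ∈ p.support, z ∉ S) →
        (∀ z, ReflTransGen (IsChild G ρ) z u → z ∉ S) →
        ∀ z, ReflTransGen (IsChild G ρ) z v → z ∉ S := by
      intro u v p
      induction p with
      | nil => exact fun _ h => h
      | @cons u w v h p ih =>
        intro hp hu
        refine ih (fun z hz => hp z (by simp [hz])) fun z hz => ?_
        rcases isChild_or_isChild (ρ := ρ) hG h with hc | hc
        · rcases ReflTransGen.cases_tail hz with e | ⟨y, hzy, hyw⟩
          · rw [← e]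
            exact hp w (by simp)
          · rw [(isForest_isChild hG ρ).unique hyw hc] at hzy
            exact hu z hzy
        · exact hu z (hz.tail hc)
    refine key p hp fun z hz => ?_
    rcases ReflTransGen.cases_tail hz with e | ⟨y, -, hy⟩
    · rw [← e]
      exact hp ρ (by simp)
    · have := hy.2
      simp at this
  · intro h
    have key : ∀ {x : V}, ReflTransGen (IsChild G ρ) ρ x →
        (∀ z, ReflTransGen (IsChild G ρ) z x → z ∉ S) → x ∈ Ins G ρ S := by
      intro x hx
      induction hx with
      | refl => exact fun h => ⟨.nil, by simpa using h ρ .refl⟩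
      | tail _ hyx ih =>
        intro h
        obtain ⟨p, hp⟩ := ih fun z hz => h z (hz.tail hyx)
        refine ⟨p.concat hyx.1, fun z hz => ?_⟩
        rw [SimpleGraph.Walk.support_concat, List.mem_append, List.mem_singleton] at hz
        rcases hz with hz | rfl
        · exact hp z hz
        · exact h _ .refl
    exact key (reflTransGen_root hG x) h

theorem IsRay.isChild (hG : G.IsTree) {γ : ℕ → V} (hγ : IsRay G ρ γ) (n : ℕ) :
    IsChild G ρ (γ n) (γ (n + 1)) := by
  induction n with
  | zero =>
    refine (isChild_or_isChild hG (hγ.2.1 0)).resolve_right fun h => ?_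
    have := h.2
    rw [hγ.1] at this
    simp at this
  | succ n ih =>
    refine (isChild_or_isChild hG (hγ.2.1 (n + 1))).resolve_right fun h => ?_
    have := hγ.2.2 ((isForest_isChild hG ρ).unique h ih)
    omega

theorem IsRay.dist_eq (hG : G.IsTree) {γ : ℕ → V} (hγ : IsRay G ρ γ) (n : ℕ) :
    G.dist ρ (γ n) = n := by
  induction n with
  | zero => simp [hγ.1]
  | succ n ih => rw [(hγ.isChild hG n).2, ih]

/-- A ray from the root contains all the ancestors of its vertices. -/
theorem IsRay.exists_eq_of_reflTransGen (hG : G.IsTree) {γ : ℕ → V} (hγ : IsRay G ρ γ) {n : ℕ}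
    {z : V} (hz : ReflTransGen (IsChild G ρ) z (γ n)) : ∃ m, z = γ m := by
  induction n with
  | zero =>
    rcases ReflTransGen.cases_tail hz with e | ⟨y, -, hy⟩
    · exact ⟨0, e.symm⟩
    · have := hy.2
      rw [hγ.1] at this
      simp at this
  | succ n ih =>
    rcases ReflTransGen.cases_tail hz with e | ⟨y, hzy, hy⟩
    · exact ⟨n + 1, e.symm⟩
    · rw [(isForest_isChild hG ρ).unique hy (hγ.isChild hG n)] at hzy
      exact ih hzy

theorem IsAntichainCutset.eq_of_reflTransGen (hG : G.IsTree) {S : Finset V}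
    (hS : IsAntichainCutset G ρ S) {y z : V} (hy : y ∈ S) (hz : z ∈ S)
    (hzy : ReflTransGen (IsChild G ρ) z y) : z = y := by
  classical
  have h := hS.2 (S.erase y) (Finset.erase_ssubset hy)
  simp only [IsCutset, not_forall, not_exists] at h
  obtain ⟨γ, hγ, hmiss⟩ := h
  obtain ⟨n, hn⟩ := hS.1 γ hγ
  have hny : γ n = y := by
    by_contra hne
    exact hmiss n (Finset.mem_erase.2 ⟨hne, hn⟩)
  rw [← hny] at hzy
  obtain ⟨m, rfl⟩ := hγ.exists_eq_of_reflTransGen hG hzy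
  by_contra hne
  exact hmiss m (Finset.mem_erase.2 ⟨hne, hz⟩)

theorem finite_ancestors (hG : G.IsTree) (x : V) :
    {v | ReflTransGen (IsChild G ρ) v x}.Finite := by
  have hF := isForest_isChild hG ρ
  refine Set.Finite.of_finite_image (f := G.dist ρ) ?_ fun v hv w hw h =>
    hF.eq_of_reflTransGen hv hw h
  refine (Set.finite_Iic (G.dist ρ x)).subset ?_
  rintro _ ⟨v, hv, rfl⟩
  rcases reflTransGen_iff_eq_or_transGen.1 hv with e | ht
  · exact (congrArg (G.dist ρ) e.symm).le
  · exact (hF.lev_lt_of_transGen ht).le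

open scoped Classical in
/-- Every cutset can be replaced by an antichain of no larger weight all of whose portions below a
vertex weigh no more than that vertex: take a cutset of minimal weight among those consisting of
ancestors of vertices in the given one. -/
theorem exists_isAntichainCutset_sum_le (hG : G.IsTree) {θ : ℝ} (hθ : 0 < θ) {S₀ : Finset V}
    (hS₀ : IsCutset G ρ S₀) : ∃ S : Finset V, IsAntichainCutset G ρ S ∧
      ∑ x ∈ S, θ ^ G.dist ρ x ≤ ∑ x ∈ S₀, θ ^ G.dist ρ x ∧
      ∀ v, ∑ x ∈ S with ReflTransGen (IsChild G ρ) v x, θ ^ G.dist ρ x ≤ θ ^ G.dist ρ v := by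
  have hfin : (⋃ x ∈ S₀, {v | ReflTransGen (IsChild G ρ) v x}).Finite :=
    S₀.finite_toSet.biUnion fun x _ => finite_ancestors hG x
  set U : Finset V := hfin.toFinset with hU
  have hmemU : ∀ v, v ∈ U ↔ ∃ x ∈ S₀, ReflTransGen (IsChild G ρ) v x := fun v => by simp [hU]
  obtain ⟨S, hS, hmin⟩ := Finset.exists_min_image (U.powerset.filter (IsCutset G ρ))
    (fun S => ∑ x ∈ S, θ ^ G.dist ρ x)
    ⟨S₀, Finset.mem_filter.2 ⟨Finset.mem_powerset.2 fun x hx => (hmemU x).2 ⟨x, hx, .refl⟩, hS₀⟩⟩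
  obtain ⟨hSU, hScut⟩ := Finset.mem_filter.1 hS
  rw [Finset.mem_powerset] at hSU
  refine ⟨S, ⟨hScut, fun S' hS' hcut => ?_⟩, ?_, fun v => ?_⟩
  · obtain ⟨x, hx, hx'⟩ := Finset.exists_of_ssubset hS'
    have hlt : ∑ x ∈ S', θ ^ G.dist ρ x < ∑ x ∈ S, θ ^ G.dist ρ x :=
      Finset.sum_lt_sum_of_subset hS'.1 hx hx' (pow_pos hθ _) fun _ _ _ => (pow_pos hθ _).le
    exact (hmin S' (Finset.mem_filter.2
      ⟨Finset.mem_powerset.2 (hS'.1.trans hSU), hcut⟩)).not_gt hlt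
  · exact hmin S₀ (Finset.mem_filter.2
      ⟨Finset.mem_powerset.2 fun x hx => (hmemU x).2 ⟨x, hx, .refl⟩, hS₀⟩)
  · by_cases hv : ∃ x ∈ S, ReflTransGen (IsChild G ρ) v x
    · obtain ⟨x, hx, hvx⟩ := hv
      -- replacing the part of `S` below `v` by `v` gives a cutset, of no smaller weight
      set T := S.filter fun x => ¬ ReflTransGen (IsChild G ρ) v x with hT
      have hvT : v ∉ T := fun h => (Finset.mem_filter.1 h).2 .refl
      have hcut : IsCutset G ρ (insert v T) := by
        intro γ hγ
        obtain ⟨n, hn⟩ := hScut γ hγ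
        by_cases hvn : ReflTransGen (IsChild G ρ) v (γ n)
        · obtain ⟨m, hm⟩ := hγ.exists_eq_of_reflTransGen hG hvn
          exact ⟨m, by rw [← hm]; exact Finset.mem_insert_self v T⟩
        · exact ⟨n, Finset.mem_insert_of_mem (Finset.mem_filter.2 ⟨hn, hvn⟩)⟩
      have hsub : insert v T ⊆ U := by
        refine Finset.insert_subset ?_ ((Finset.filter_subset _ _).trans hSU)
        obtain ⟨y, hy, hxy⟩ := (hmemU x).1 (hSU hx)
        exact (hmemU v).2 ⟨y, hy, hvx.trans hxy⟩
      have h1 := hmin (insert v T) (Finset.mem_filter.2 ⟨Finset.mem_powerset.2 hsub, hcut⟩)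
      simp only [Finset.sum_insert hvT] at h1
      have h2 := Finset.sum_filter_add_sum_filter_not S
        (fun x => ReflTransGen (IsChild G ρ) v x) fun x => θ ^ G.dist ρ x
      rw [← hT] at h2
      linarith
    · rw [Finset.filter_false_of_mem fun x hx h => hv ⟨x, hx, h⟩, Finset.sum_empty]
      exact (pow_pos hθ _).le

end Tree

/-! ### From small chi-square to non-solvability -/

section Reconstruction

open Relation

variable {V A B : Type*} [Fintype A] [Fintype B] {G : SimpleGraph V} {ρ : V}

/-- The edges of the closed inside of a cutset along which the chain is run. -/
def InsEdge (G : SimpleGraph V) (ρ : V) (S : Finset V) (x y : InsClosure G ρ S) : Prop :=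
  (x : V) ∈ Ins G ρ S ∧ IsChild G ρ x y

theorem isForest_insEdge (hG : G.IsTree) (ρ : V) (S : Finset V) :
    IsForest (InsEdge G ρ S) fun x => G.dist ρ x where
  unique hx hy := Subtype.ext ((isForest_isChild hG ρ).unique hx.2 hy.2)
  lev_succ h := h.2.2

theorem reflTransGen_insEdge_root (hG : G.IsTree) {S : Finset V} (hS : IsAntichainCutset G ρ S)
    (y : InsClosure G ρ S) :
    ReflTransGen (InsEdge G ρ S) ⟨ρ, root_mem_insClosure G ρ S⟩ y := by
  obtain ⟨y, hy⟩ := y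
  have key : ∀ {y : V}, ReflTransGen (IsChild G ρ) ρ y → ∀ hy : y ∈ InsClosure G ρ S,
      ReflTransGen (InsEdge G ρ S) ⟨ρ, root_mem_insClosure G ρ S⟩ ⟨y, hy⟩ := by
    intro y h
    induction h with
    | refl => exact fun _ => .refl
    | @tail x y _ hxy ih =>
      intro hy
      have hx : x ∈ Ins G ρ S := by
        rw [mem_ins_iff hG]
        rcases hy with hy | hy
        · exact fun z hz => (mem_ins_iff hG).1 hy z (hz.tail hxy)
        · intro z hz hzS
          have h1 := hS.eq_of_reflTransGen hG hy hzS (hz.tail hxy)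
          have h2 := (isForest_isChild hG ρ).lev_lt_of_transGen (TransGen.tail' hz hxy)
          rw [h1] at h2
          exact h2.false
      exact (ih (Or.inl hx)).tail ⟨hx, hxy⟩
  exact key (reflTransGen_root hG y) hy

open scoped Classical in
/-- The observed law is the likelihood at the root, up to normalisation. -/
theorem likelihood_eq_observedLaw [Nonempty A] (hG : G.IsTree) {S : Finset V}
    (hS : IsAntichainCutset G ρ S) [Fintype (InsClosure G ρ S)] (M : Matrix A A ℝ)
    (N : Matrix A B ℝ) (τ : S → B) (i : A) :
    likelihood (InsEdge G ρ S) (fun y : S => ⟨y, Or.inr y.2⟩) M N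
        ⟨ρ, root_mem_insClosure G ρ S⟩ τ i =
      (Fintype.card B : ℝ) ^ Fintype.card S * observedLaw G ρ S M N i τ := by
  rw [(isForest_insEdge hG ρ S).likelihood_root (reflTransGen_insEdge_root hG hS), observedLaw,
    finsum_eq_sum_of_fintype]
  congr 1
  refine Finset.sum_congr (by ext; simp) fun σ _ => ?_
  rw [jointWeight, finprod_eq_prod_of_fintype]
  exact congrArg₂ _ (congrArg₂ _ rfl (Finset.prod_congr rfl fun p _ =>
    if_congr Iff.rfl rfl rfl)) rfl

open scoped Classical in
/-- The total variation distance between the observed laws is controlled by the weight of the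
antichain, provided every single observation carries little information. -/
theorem tvDist_observedLaw_le [Nonempty A] [Nonempty B] (hG : G.IsTree) {K : ℕ}
    (hK : ∀ x : V, (G.neighborSet x).encard ≤ K) {S : Finset V}
    (hS : IsAntichainCutset G ρ S) {M : Matrix A A ℝ} {N : Matrix A B ℝ}
    (hM0 : ∀ i j, 0 ≤ M i j) (hM1 : ∀ i, ∑ j, M i j = 1)
    (hN0 : ∀ a b, 0 ≤ N a b) (hN1 : ∀ a, ∑ b, N a b = 1)
    {H : Type*} [NormedAddCommGroup H] [InnerProductSpace ℝ H]
    {π : A → ℝ} {ℓ : (A → ℝ) →ₗ[ℝ] H} (hℓ : IsContrast π ℓ) (hπ : π ᵥ* M = π)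
    {s : ℝ} (hMℓ : ∀ v, ‖ℓ (M *ᵥ v)‖ ≤ s * ‖ℓ v‖)
    {C : ℝ} (hC : 0 ≤ C) (hmul : HasProductConstant π ℓ C) {δ θ : ℝ} (hδ : 0 ≤ δ) (hθ0 : 0 < θ)
    (hθ : (1 + C * √δ) ^ K * s ^ 2 ≤ θ)
    (hSθ : ∀ v, ∑ x ∈ S with ReflTransGen (IsChild G ρ) v x, θ ^ G.dist ρ x ≤ θ ^ G.dist ρ v)
    (hNδ : S.Nonempty → ∑ b, chiSq π ℓ (fun a => N a b) ≤ δ) (i j : A) :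
    tvDist (observedLaw G ρ S M N i) (observedLaw G ρ S M N j) ≤
      √(δ * ∑ x ∈ S, θ ^ G.dist ρ x) := by
  have hF := isForest_isChild hG ρ
  let instW : Fintype (InsClosure G ρ S) := (finite_insClosure G ⟨K, hK⟩ ρ S hS.1).fintype
  set e : S → InsClosure G ρ S := fun y => ⟨y, Or.inr y.2⟩ with he
  have hinj : Function.Injective e := fun x y h => by
    have hxy : (e x : V) = e y := congrArg Subtype.val h
    exact Subtype.ext hxy
  set Y : InsClosure G ρ S → ℝ := fun v =>
    (∑ x ∈ S with ReflTransGen (IsChild G ρ) v x, θ ^ G.dist ρ x) / θ ^ G.dist ρ v with hY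
  have hsum0 : ∀ v, 0 ≤ ∑ x ∈ S with ReflTransGen (IsChild G ρ) v x, θ ^ G.dist ρ x := fun v =>
    Finset.sum_nonneg fun x _ => (pow_pos hθ0 _).le
  set o : InsClosure G ρ S := ⟨ρ, root_mem_insClosure G ρ S⟩ with ho
  set Z : (S → B) → A → ℝ := likelihood (InsEdge G ρ S) e M N o with hZ
  have hmain : 𝔼 τ, chiSq π ℓ (Z τ) ≤ δ * Y o := by
    refine (isForest_insEdge hG ρ S).expect_chiSq_likelihood_le hinj hM0 hM1 hN0 hN1 hℓ hπ hMℓ hC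
      hmul hδ hθ (Y := Y) (fun v => div_nonneg (hsum0 v) (pow_pos hθ0 _).le)
      (fun v => (div_le_one (pow_pos hθ0 _)).2 (hSθ v)) ?_ ?_ ?_ ?_
      (fun y => hNδ ⟨y, y.2⟩) o
    · intro y
      have : S.filter (fun x => ReflTransGen (IsChild G ρ) (y : V) x) = {(y : V)} := by
        ext x
        rw [Finset.mem_filter, Finset.mem_singleton]
        constructor
        · exact fun hx => (hS.eq_of_reflTransGen hG hx.1 y.2 hx.2).symm
        · rintro rfl
          exact ⟨y.2, .refl⟩
      simp only [hY, he]
      rw [this, Finset.sum_singleton, div_self (pow_pos hθ0 _).ne']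
    · intro v
      have h1 : ∀ c ∈ Finset.univ.filter (fun c => InsEdge G ρ S v c), θ * Y c =
          (∑ x ∈ S with ReflTransGen (IsChild G ρ) c x, θ ^ G.dist ρ x) / θ ^ G.dist ρ v := by
        intro c hc
        simp only [hY]
        rw [(Finset.mem_filter.1 hc).2.2.2, pow_succ]
        field_simp
      rw [Finset.mul_sum, Finset.sum_congr rfl h1, ← Finset.sum_div]
      refine div_le_div_of_nonneg_right ?_ (pow_pos hθ0 _).le
      rw [← Finset.sum_biUnion]
      · refine Finset.sum_le_sum_of_subset_of_nonneg ?_ fun x _ _ => (pow_pos hθ0 _).le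
        intro x hx
        obtain ⟨c, hc, hx⟩ := Finset.mem_biUnion.1 hx
        obtain ⟨hxS, hcx⟩ := Finset.mem_filter.1 hx
        exact Finset.mem_filter.2 ⟨hxS, hcx.head (Finset.mem_filter.1 hc).2.2⟩
      · intro c hc d hd hcd
        have hvc : IsChild G ρ v c := (Finset.mem_filter.1 hc).2.2
        have hvd : IsChild G ρ v d := (Finset.mem_filter.1 hd).2.2
        refine Finset.disjoint_left.2 fun x hx hx' => hcd (Subtype.ext ?_)
        exact hF.eq_of_reflTransGen (Finset.mem_filter.1 hx).2 (Finset.mem_filter.1 hx').2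
          (hvc.2.trans hvd.2.symm)
    · intro v
      have h1 : ((Finset.univ.filter fun c => InsEdge G ρ S v c).map
          (Function.Embedding.subtype _) : Set V) ⊆ G.neighborSet v := by
        intro x hx
        obtain ⟨c, hc, rfl⟩ := Finset.mem_map.1 (Finset.mem_coe.1 hx)
        exact (Finset.mem_filter.1 hc).2.2.1
      have h2 := (Set.encard_le_encard h1).trans (hK v)
      rw [Set.encard_coe_eq_coe_finsetCard, Finset.card_map] at h2
      exact_mod_cast h2
    · intro y c hyc
      exact (mem_ins_iff hG).1 hyc.1 y .refl y.2
  have hYo : Y o = ∑ x ∈ S, θ ^ G.dist ρ x := by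
    simp only [hY, ho, SimpleGraph.dist_self, pow_zero, div_one]
    rw [Finset.filter_true_of_mem fun x _ => reflTransGen_root hG x]
  rw [hYo] at hmain
  have hZ0 : ∀ τ a, 0 ≤ Z τ a := fun τ a =>
    (isForest_insEdge hG ρ S).likelihood_nonneg hM0 hN0 o τ a
  have hZ1 : ∀ a, 𝔼 τ, Z τ a = 1 := fun a =>
    (isForest_insEdge hG ρ S).expect_likelihood hinj hM1 hN1 o a
  have hZobs : ∀ τ a, Z τ a =
      (Fintype.card B : ℝ) ^ Fintype.card S * observedLaw G ρ S M N a τ := fun τ a =>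
    likelihood_eq_observedLaw hG hS M N τ a
  have hB : (0 : ℝ) < (Fintype.card B : ℝ) ^ Fintype.card S :=
    pow_pos (Nat.cast_pos.2 Fintype.card_pos) _
  calc tvDist (observedLaw G ρ S M N i) (observedLaw G ρ S M N j)
      = 1 / 2 * 𝔼 τ, |Z τ i - Z τ j| := by
        rw [tvDist, Fintype.expect_eq_sum_div_card, Fintype.card_fun, Nat.cast_pow]
        congr 1
        rw [eq_div_iff hB.ne', Finset.sum_mul]
        refine Finset.sum_congr rfl fun τ _ => ?_
        rw [hZobs, hZobs, ← mul_sub, abs_mul, abs_of_pos hB, mul_comm]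
    _ ≤ 1 / 2 * 𝔼 τ, 2 * ‖ℓ (Z τ)‖ := by
        refine mul_le_mul_of_nonneg_left (Finset.expect_le_expect fun τ _ => ?_) (by norm_num)
        have h1 := abs_le.1 (hℓ.abs_sub_le (Z τ) i)
        have h2 := abs_le.1 (hℓ.abs_sub_le (Z τ) j)
        exact abs_le.2 ⟨by linarith, by linarith⟩
    _ = 𝔼 τ, ‖ℓ (Z τ)‖ := by rw [← Finset.mul_expect]; ring
    _ ≤ √(𝔼 τ, chiSq π ℓ (Z τ)) := hℓ.expect_norm_le hZ0 hZ1
    _ ≤ _ := Real.sqrt_le_sqrt hmain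

theorem tvDist_nonneg {Ω : Type*} [Fintype Ω] (μ ν : Ω → ℝ) : 0 ≤ tvDist μ ν :=
  mul_nonneg (by norm_num) (Finset.sum_nonneg fun _ _ => abs_nonneg _)

/-- If there are cutsets of arbitrarily small weight and single observations carry little
information (or no observations are needed at all), reconstruction is not solvable. -/
theorem not_solvableThrough [Nonempty A] [Nonempty B] (hG : G.IsTree) {K : ℕ}
    (hK : ∀ x : V, (G.neighborSet x).encard ≤ K) {M : Matrix A A ℝ} {N : Matrix A B ℝ}
    (hM0 : ∀ i j, 0 ≤ M i j) (hM1 : ∀ i, ∑ j, M i j = 1)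
    (hN0 : ∀ a b, 0 ≤ N a b) (hN1 : ∀ a, ∑ b, N a b = 1)
    {H : Type*} [NormedAddCommGroup H] [InnerProductSpace ℝ H]
    {π : A → ℝ} {ℓ : (A → ℝ) →ₗ[ℝ] H} (hℓ : IsContrast π ℓ) (hπ : π ᵥ* M = π)
    {s : ℝ} (hMℓ : ∀ v, ‖ℓ (M *ᵥ v)‖ ≤ s * ‖ℓ v‖)
    {C : ℝ} (hC : 0 ≤ C) (hmul : HasProductConstant π ℓ C) {δ θ : ℝ} (hδ : 0 ≤ δ) (hθ0 : 0 < θ)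
    (hθ : (1 + C * √δ) ^ K * s ^ 2 ≤ θ)
    (hcut : ∀ η > 0, ∃ S, IsCutset G ρ S ∧ ∑ x ∈ S, θ ^ G.dist ρ x < η)
    (hNδ : ¬ IsCutset G ρ ∅ → ∑ b, chiSq π ℓ (fun a => N a b) ≤ δ) :
    ¬ SolvableThrough G ρ M N := by
  classical
  rintro ⟨i, j, hij⟩
  set x := ⨅ S : {S : Finset V // IsAntichainCutset G ρ S},
    tvDist (observedLaw G ρ S.1 M N i) (observedLaw G ρ S.1 M N j) with hx
  obtain ⟨S₀, hS₀, hlt⟩ := hcut (x ^ 2 / (δ + 1)) (by positivity)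
  obtain ⟨S, hS, hSS₀, hSθ⟩ := exists_isAntichainCutset_sum_le hG hθ0 hS₀
  have h1 : x ≤ tvDist (observedLaw G ρ S M N i) (observedLaw G ρ S M N j) :=
    ciInf_le (f := fun S : {S : Finset V // IsAntichainCutset G ρ S} =>
      tvDist (observedLaw G ρ S.1 M N i) (observedLaw G ρ S.1 M N j))
      ⟨0, by rintro _ ⟨S, rfl⟩; exact tvDist_nonneg _ _⟩ ⟨S, hS⟩
  have h2 : tvDist (observedLaw G ρ S M N i) (observedLaw G ρ S M N j) ≤
      √(δ * ∑ x ∈ S, θ ^ G.dist ρ x) := by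
    refine tvDist_observedLaw_le hG hK hS hM0 hM1 hN0 hN1 hℓ hπ hMℓ hC hmul hδ hθ0 hθ ?_
      (fun hne => hNδ fun h0 => hS.2 ∅ (Finset.empty_ssubset.2 hne) h0) i j
    convert hSθ
  have h3 : √(δ * ∑ x ∈ S, θ ^ G.dist ρ x) < x := by
    rw [Real.sqrt_lt' hij]
    calc δ * ∑ x ∈ S, θ ^ G.dist ρ x ≤ (δ + 1) * ∑ x ∈ S, θ ^ G.dist ρ x := by
          refine mul_le_mul_of_nonneg_right (by linarith)
            (Finset.sum_nonneg fun x _ => (pow_pos hθ0 _).le)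
      _ < (δ + 1) * (x ^ 2 / (δ + 1)) :=
          mul_lt_mul_of_pos_left (hSS₀.trans_lt hlt) (by linarith)
      _ = x ^ 2 := by field_simp
  linarith

end Reconstruction

/-! ### The branching number and cutsets of small weight -/

section Branching

variable {V : Type*} {G : SimpleGraph V} {ρ : V}

theorem exists_level_finset (hG : G.IsTree) {K : ℕ}
    (hK : ∀ x : V, (G.neighborSet x).encard ≤ K) (n : ℕ) :
    ∃ L : Finset V, (∀ x, x ∈ L ↔ G.dist ρ x = n) ∧ L.card ≤ K ^ n := by
  classical
  induction n with
  | zero =>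
    refine ⟨{ρ}, fun x => ?_, by simp⟩
    rw [Finset.mem_singleton, hG.connected.dist_eq_zero_iff, eq_comm]
  | succ n ih =>
    obtain ⟨L, hL, hcard⟩ := ih
    have hfin : ∀ x, (G.neighborSet x).Finite := fun x =>
      Set.encard_lt_top_iff.1 ((hK x).trans_lt (ENat.natCast_lt_top K))
    refine ⟨(L.biUnion fun x => (hfin x).toFinset).filter fun y => G.dist ρ y = n + 1,
      fun y => ?_, ?_⟩
    · rw [Finset.mem_filter, and_iff_right_iff_imp]
      intro hy
      rcases Relation.ReflTransGen.cases_tail (reflTransGen_root (ρ := ρ) hG y) with e | ⟨x, -, hx⟩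
      · rw [e] at hy
        simp at hy
      · refine Finset.mem_biUnion.2 ⟨x, (hL x).2 ?_, by simpa using hx.1⟩
        have := hx.2
        omega
    · refine (Finset.card_filter_le _ _).trans ?_
      rw [pow_succ]
      refine (Finset.card_biUnion_le_card_mul L _ K fun x _ => ?_).trans
        (Nat.mul_le_mul_right K hcard)
      have := hK x
      rw [(hfin x).encard_eq_coe_toFinset_card] at this
      exact_mod_cast this

theorem isCutset_singleton_root : IsCutset G ρ {ρ} := fun _ hγ =>
  ⟨0, Finset.mem_singleton.2 hγ.1⟩

/-- The set in the definition of the branching number is not empty: it contains every number larger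
than all degrees, by the cutsets formed by the levels of the tree. -/
theorem exists_iInf_cutset_eq_zero (hG : G.IsTree) (hdeg : BoundedDegree G) (ρ : V) :
    ∃ r : ℝ, 0 < r ∧
      ⨅ S : {S : Finset V // IsCutset G ρ S}, ∑ x ∈ S.1, r ^ (-(G.dist ρ x : ℤ)) = 0 := by
  obtain ⟨K, hK⟩ := hdeg
  have hr : (0 : ℝ) < K + 1 := by positivity
  refine ⟨K + 1, hr, le_antisymm ?_ (Real.iInf_nonneg fun S =>
    Finset.sum_nonneg fun x _ => (zpow_pos hr _).le)⟩
  have hlim : Filter.Tendsto (fun n : ℕ => ((K : ℝ) / (K + 1)) ^ n) Filter.atTop (nhds 0) :=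
    tendsto_pow_atTop_nhds_zero_of_lt_one (by positivity) ((div_lt_one hr).2 (lt_add_one _))
  refine ge_of_tendsto' hlim fun n => ?_
  obtain ⟨L, hL, hcard⟩ := exists_level_finset (ρ := ρ) hG hK n
  have hcut : IsCutset G ρ L := fun γ hγ => ⟨n, (hL _).2 (hγ.dist_eq hG n)⟩
  refine (ciInf_le (f := fun S : {S : Finset V // IsCutset G ρ S} =>
    ∑ x ∈ S.1, ((K : ℝ) + 1) ^ (-(G.dist ρ x : ℤ)))
    ⟨0, by
      rintro _ ⟨S, rfl⟩
      exact Finset.sum_nonneg fun x _ => (zpow_pos hr _).le⟩ ⟨L, hcut⟩).trans ?_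
  calc ∑ x ∈ L, ((K : ℝ) + 1) ^ (-(G.dist ρ x : ℤ)) = ∑ x ∈ L, (((K : ℝ) + 1) ^ n)⁻¹ := by
        refine Finset.sum_congr rfl fun x hx => ?_
        rw [(hL x).1 hx, zpow_neg, zpow_natCast]
    _ = (L.card : ℝ) * (((K : ℝ) + 1) ^ n)⁻¹ := by rw [Finset.sum_const, nsmul_eq_mul]
    _ ≤ (K : ℝ) ^ n * (((K : ℝ) + 1) ^ n)⁻¹ := by
        gcongr
        exact_mod_cast hcard
    _ = _ := by rw [div_pow, div_eq_mul_inv]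

/-- Unless the tree has no rays, `br(T) a² < 1` yields a number `θ < 1` larger than `a²` such that
there are cutsets of arbitrarily small weight `∑ θ ^ |x|`. -/
theorem exists_theta_of_branchingNumber (hG : G.IsTree) (hdeg : BoundedDegree G)
    (hray : ¬ IsCutset G ρ ∅) {a : ℝ} (h : branchingNumber G ρ * a ^ 2 < 1) :
    ∃ θ : ℝ, 0 < θ ∧ θ < 1 ∧ a ^ 2 < θ ∧
      ∀ η > 0, ∃ S, IsCutset G ρ S ∧ ∑ x ∈ S, θ ^ G.dist ρ x < η := by
  have hne : Nonempty {S : Finset V // IsCutset G ρ S} := ⟨⟨{ρ}, isCutset_singleton_root⟩⟩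
  obtain ⟨r₀, hr₀⟩ := exists_iInf_cutset_eq_zero hG hdeg ρ
  obtain ⟨r, hr, hra⟩ : ∃ r ∈ {r : ℝ | 0 < r ∧
      ⨅ S : {S : Finset V // IsCutset G ρ S}, ∑ x ∈ S.1, r ^ (-(G.dist ρ x : ℤ)) = 0},
      r * a ^ 2 < 1 := by
    rcases (sq_nonneg a).eq_or_lt with ha | ha
    · exact ⟨r₀, hr₀, by rw [← ha]; simp⟩
    · obtain ⟨r, hr, hlt⟩ := exists_lt_of_csInf_lt ⟨r₀, hr₀⟩ ((lt_div_iff₀ ha).2 h)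
      exact ⟨r, hr, (lt_div_iff₀ ha).1 hlt⟩
  obtain ⟨hr0, hinf⟩ := hr
  have hzpow : ∀ n : ℕ, r ^ (-(n : ℤ)) = r⁻¹ ^ n := fun n => by
    rw [zpow_neg, zpow_natCast, inv_pow]
  simp_rw [hzpow] at hinf
  -- for `r ≤ 1` every nonempty cutset has weight at least one
  have hr1 : 1 < r := by
    by_contra! hr1
    have h1 : (1 : ℝ) ≤
        ⨅ S : {S : Finset V // IsCutset G ρ S}, ∑ x ∈ S.1, r⁻¹ ^ G.dist ρ x := by
      refine le_ciInf fun S => ?_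
      obtain ⟨x, hx⟩ : S.1.Nonempty := by
        rw [Finset.nonempty_iff_ne_empty]
        intro h0
        exact hray (h0 ▸ S.2)
      calc (1 : ℝ) ≤ r⁻¹ ^ G.dist ρ x := one_le_pow₀ ((one_le_inv₀ hr0).2 hr1)
        _ ≤ _ := Finset.single_le_sum (f := fun x => r⁻¹ ^ G.dist ρ x)
          (fun x _ => (pow_pos (inv_pos.2 hr0) _).le) hx
    rw [hinf] at h1
    linarith
  refine ⟨r⁻¹, inv_pos.2 hr0, inv_lt_one_of_one_lt₀ hr1, ?_, fun η hη => ?_⟩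
  · calc a ^ 2 = r⁻¹ * (r * a ^ 2) := (inv_mul_cancel_left₀ hr0.ne' _).symm
      _ < r⁻¹ * 1 := mul_lt_mul_of_pos_left hra (inv_pos.2 hr0)
      _ = r⁻¹ := mul_one _
  · rw [gt_iff_lt, ← hinf] at hη
    obtain ⟨S, hS⟩ := exists_lt_of_ciInf_lt hη
    exact ⟨S.1, S.2, hS⟩

end Branching

/-! ### The chi-square of the three kinds of noise -/

section Noise

variable {A H : Type*} [Fintype A] [DecidableEq A] [NormedAddCommGroup H] [InnerProductSpace ℝ H]
  {π : A → ℝ} {ℓ : (A → ℝ) →ₗ[ℝ] H}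

/-- Observing through `k` further steps of the chain decreases the chi-square geometrically. -/
theorem IsContrast.sum_chiSq_pow_le (h : IsContrast π ℓ) {M : Matrix A A ℝ} {s : ℝ}
    (hM : M ∈ Matrix.rowStochastic ℝ A) (hπ : π ᵥ* M = π)
    (hMℓ : ∀ v, ‖ℓ (M *ᵥ v)‖ ≤ s * ‖ℓ v‖) (k : ℕ) :
    ∑ b, chiSq π ℓ (fun a => (M ^ k) a b) ≤
      (s ^ 2) ^ k * ∑ b, chiSq π ℓ (fun a => (1 : Matrix A A ℝ) a b) := by
  induction k with
  | zero => simp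
  | succ k ih =>
    calc ∑ b, chiSq π ℓ (fun a => (M ^ (k + 1)) a b)
        ≤ ∑ b, s ^ 2 * chiSq π ℓ (fun a => (M ^ k) a b) := by
          refine Finset.sum_le_sum fun b _ => ?_
          have e : (fun a => (M ^ (k + 1)) a b) = M *ᵥ fun a => (M ^ k) a b := by
            funext a
            rw [pow_succ', Matrix.mul_apply]
            rfl
          rw [e]
          exact h.chiSq_mulVec_le hπ hMℓ fun a =>
            Matrix.nonneg_of_mem_rowStochastic (pow_mem hM k)
      _ ≤ s ^ 2 * ((s ^ 2) ^ k * ∑ b, chiSq π ℓ (fun a => (1 : Matrix A A ℝ) a b)) := by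
          rw [← Finset.mul_sum]
          exact mul_le_mul_of_nonneg_left ih (sq_nonneg s)
      _ = _ := by rw [pow_succ' (s ^ 2), mul_assoc]

/-- Resampling is less informative than erasure: the chi-square is at most linear in the probability
`t` of a genuine observation. -/
theorem IsContrast.sum_chiSq_resamplingNoise_le (h : IsContrast π ℓ) {ν : A → ℝ}
    (hν : ∀ i, 0 ≤ ν i) {t : ℝ} (ht0 : 0 < t) (ht1 : t ≤ 1) :
    ∑ b, chiSq π ℓ (fun a => resamplingNoise ν (1 - t) a b) ≤
      t * ∑ b, chiSq π ℓ (fun a => (1 : Matrix A A ℝ) a b) := by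
  rw [Finset.mul_sum]
  refine Finset.sum_le_sum fun b _ => ?_
  have hpos : ∀ i, 0 ≤ (1 : Matrix A A ℝ) i b := fun i => by
    rw [Matrix.one_apply]
    split_ifs <;> norm_num
  set z : A → ℝ := fun a => (1 : Matrix A A ℝ) a b with hz
  have e : (fun a => resamplingNoise ν (1 - t) a b) = t • z + ((1 - t) * ν b) • 1 := by
    funext a
    simp [resamplingNoise, hz, Matrix.one_apply]
  have hπ1 : π ⬝ᵥ (1 : A → ℝ) = 1 := by simpa [dotProduct] using h.sum_eq_one
  have hzb : 0 < π ⬝ᵥ z := by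
    have : π ⬝ᵥ z = π b := by simp [hz, dotProduct, Matrix.one_apply]
    rw [this]
    exact h.pos b
  rw [← chiSq_smul t ht0.le, e, chiSq, chiSq, map_add, map_smul ℓ ((1 - t) * ν b), h.map_one,
    smul_zero, add_zero, dotProduct_add, dotProduct_smul, dotProduct_smul, hπ1]
  have h2 : 0 ≤ (1 - t) * ν b := mul_nonneg (by linarith) (hν b)
  simp only [smul_eq_mul, mul_one]
  exact div_le_div_of_nonneg_left (sq_nonneg _) (mul_pos ht0 hzb) (by linarith)

theorem IsContrast.sum_chiSq_erasureNoise (h : IsContrast π ℓ) {t : ℝ} (ht0 : 0 < t) :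
    ∑ b, chiSq π ℓ (fun a => erasureNoise A (1 - t) a b) =
      t * ∑ b, chiSq π ℓ (fun a => (1 : Matrix A A ℝ) a b) := by
  rw [Fintype.sum_option, Finset.mul_sum]
  have h1 : (fun a => erasureNoise A (1 - t) a none) = (1 - t) • (1 : A → ℝ) := by
    funext a
    simp [erasureNoise]
  have h2 : ∀ b, (fun a => erasureNoise A (1 - t) a (some b)) =
      t • fun a => (1 : Matrix A A ℝ) a b := by
    intro b
    funext a
    simp [erasureNoise, Matrix.one_apply]
  simp_rw [h1, h2, chiSq_smul t ht0.le]
  rw [chiSq, map_smul, h.map_one]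
  simp

end Noise

/-- Strict inequality leaves room for the loss factor of merging `K` children, once the chi-squares
are at most a small `δ`. -/
theorem exists_pos_loss_le {C s θ : ℝ} (K : ℕ) (h : s ^ 2 < θ) :
    ∃ δ : ℝ, 0 < δ ∧ (1 + C * √δ) ^ K * s ^ 2 ≤ θ := by
  have hcont : Continuous fun δ : ℝ => (1 + C * √δ) ^ K * s ^ 2 := by fun_prop
  have h0 : (1 + C * √0) ^ K * s ^ 2 < θ := by simpa using h
  have hev : ∀ᶠ δ in nhdsWithin (0 : ℝ) (Set.Ioi 0), (1 + C * √δ) ^ K * s ^ 2 < θ :=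
    (hcont.tendsto 0).mono_left nhdsWithin_le_nhds |>.eventually (gt_mem_nhds h0)
  obtain ⟨δ, hδ, hδ0⟩ := (hev.and self_mem_nhdsWithin).exists
  exact ⟨δ, hδ0, hδ.le⟩

theorem theorem3p3 {V A : Type*} [Fintype A] [DecidableEq A]
    (G : SimpleGraph V) (hG : G.IsTree) (hdeg : BoundedDegree G) (ρ : V)
    (M : Matrix A A ℝ) (hM : IsErgodicChain M)
    (hbr : branchingNumber G ρ * absSecondEigenvalue M ^ 2 < 1) :
    ¬ RobustSolvable G ρ M ∧
    (∀ ν : A → ℝ, IsNondegenerateDistribution ν → ¬ NuRobustSolvable G ρ M ν) ∧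
    ((∀ i j, M i j ≠ 0) → ¬ ErasureRobustSolvable G ρ M) := by
  cases isEmpty_or_nonempty A with
  | inl hA =>
    refine ⟨fun h => ?_, fun ν _ h => ?_, fun _ h => ?_⟩
    · obtain ⟨i, -⟩ := h 0
      exact hA.elim i
    · obtain ⟨i, -⟩ := h 0 le_rfl one_pos
      exact hA.elim i
    · obtain ⟨i, -⟩ := h 0 le_rfl one_pos
      exact hA.elim i
  | inr hA =>
    obtain ⟨hMst, hirr, -⟩ := hM
    have hM0 : ∀ i j, 0 ≤ M i j := fun i j => Matrix.nonneg_of_mem_rowStochastic hMst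
    have hM1 : ∀ i, ∑ j, M i j = 1 := Matrix.sum_row_of_mem_rowStochastic hMst
    have hlam := absSecondEigenvalue_nonneg M
    -- In a tree without rays the empty cutset is available and every `s`, `θ` will do.
    obtain ⟨s, θ, hs, hsθ, hs1, hθ0, hcut⟩ : ∃ s θ : ℝ, absSecondEigenvalue M < s ∧ s ^ 2 < θ ∧
        (¬ IsCutset G ρ ∅ → s < 1) ∧ 0 < θ ∧
        ∀ η > 0, ∃ S, IsCutset G ρ S ∧ ∑ x ∈ S, θ ^ G.dist ρ x < η := by
      by_cases hray : IsCutset G ρ ∅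
      · exact ⟨absSecondEigenvalue M + 1, (absSecondEigenvalue M + 1) ^ 2 + 1, lt_add_one _,
          lt_add_one _, fun h => absurd hray h, by positivity,
          fun η hη => ⟨∅, hray, by simpa using hη⟩⟩
      · obtain ⟨θ, hθ0, hθ1, hlt, hcut⟩ := exists_theta_of_branchingNumber hG hdeg hray hbr
        obtain ⟨s, hs, hsθ⟩ := exists_between (Real.lt_sqrt_of_sq_lt hlt)
        have hs0 : 0 ≤ s := hlam.trans hs.le
        refine ⟨s, θ, hs, (Real.lt_sqrt hs0).1 hsθ, fun _ => hsθ.trans ?_, hθ0, hcut⟩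
        rwa [Real.sqrt_lt' one_pos, one_pow]
    have hs0 : 0 < s := hlam.trans_lt hs
    obtain ⟨π, m, ℓ, hℓ, hπ, hMℓ⟩ := exists_contrast hMst hirr hs
    obtain ⟨C, hC, hmul⟩ := hℓ.exists_hasProductConstant
    obtain ⟨K, hK⟩ := hdeg
    obtain ⟨δ, hδ, hloss⟩ := exists_pos_loss_le (C := C) K hsθ
    -- `Q` is the chi-square of a perfect observation, and `t` the probability of a genuine one.
    set Q := ∑ b, chiSq π ℓ (fun a => (1 : Matrix A A ℝ) a b) with hQ
    have hQ0 : 0 ≤ Q := Finset.sum_nonneg fun b _ => hℓ.chiSq_nonneg fun a => by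
      rw [Matrix.one_apply]
      split_ifs <;> norm_num
    obtain ⟨t, ht0, ht1, htQ⟩ : ∃ t : ℝ, 0 < t ∧ t ≤ 1 ∧ t * Q ≤ δ := by
      refine ⟨min 1 (δ / (Q + 1)), by positivity, min_le_left _ _, ?_⟩
      calc min 1 (δ / (Q + 1)) * Q ≤ δ / (Q + 1) * (Q + 1) := by
            gcongr
            · exact min_le_right _ _
            · linarith
        _ = δ := div_mul_cancel₀ _ (by positivity)
    refine ⟨fun h => ?_, fun ν hν h => ?_, fun _ h => ?_⟩
    · obtain ⟨k, hk⟩ : ∃ k : ℕ, ¬ IsCutset G ρ ∅ → (s ^ 2) ^ k * Q ≤ δ := by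
        by_cases hray : IsCutset G ρ ∅
        · exact ⟨0, fun h => absurd hray h⟩
        · have hlim := (tendsto_pow_atTop_nhds_zero_of_lt_one (sq_nonneg s)
            (pow_lt_one₀ hs0.le (hs1 hray) two_ne_zero)).mul_const Q
          rw [zero_mul] at hlim
          obtain ⟨k, hk⟩ := (hlim.eventually (gt_mem_nhds hδ)).exists
          exact ⟨k, fun _ => hk.le⟩
      have hMk := pow_mem hMst k
      exact not_solvableThrough hG hK hM0 hM1
        (fun _ _ => Matrix.nonneg_of_mem_rowStochastic hMk)
        (Matrix.sum_row_of_mem_rowStochastic hMk) hℓ hπ hMℓ hC hmul hδ.le hθ0 hloss hcut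
        (fun hray => (hℓ.sum_chiSq_pow_le hMst hπ hMℓ k).trans (hk hray)) (h k)
    · refine not_solvableThrough hG hK hM0 hM1 (fun a b => ?_) (fun a => ?_) hℓ hπ hMℓ hC hmul
        hδ.le hθ0 hloss hcut
        (fun _ => (hℓ.sum_chiSq_resamplingNoise_le (fun i => (hν.1 i).le) ht0 ht1).trans htQ)
        (h (1 - t) (by linarith) (by linarith))
      · have := (hν.1 b).le
        have h1 : 0 ≤ 1 - t := by linarith
        simp only [resamplingNoise, Matrix.of_apply, sub_sub_cancel]
        split_ifs <;> positivity
      · simp only [resamplingNoise, Matrix.of_apply, Finset.sum_add_distrib, ← Finset.mul_sum, hν.2]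
        simp
    · refine not_solvableThrough hG hK hM0 hM1 (fun a b => ?_) (fun a => ?_) hℓ hπ hMℓ hC hmul
        hδ.le hθ0 hloss hcut
        (fun _ => (hℓ.sum_chiSq_erasureNoise ht0).trans_le htQ)
        (h (1 - t) (by linarith) (by linarith))
      · have h1 : 0 ≤ 1 - t := by linarith
        cases b with
        | none => simpa [erasureNoise] using ht1
        | some b =>
          simp only [erasureNoise, Matrix.of_apply, Option.elim_some, sub_sub_cancel]
          split_ifs <;> positivity
      · rw [Fintype.sum_option]
        simp [erasureNoise]
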